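/- A two-counter machine $M$ with fork consists of a set $S$ of states, states $q_I,q_F\in S$ (initial and final), and five finite sets of instructions, written $q_i\xrightarrow{+_A}q_j$, $q_i\xrightarrow{-_A}q_j$, $q_i\xrightarrow{+_B}q_j$, $q_i\xrightarrow{-_B}q_j$ and $q_i\xrightarrow{\mathit{fork}}q_j,q_k$. An instantaneous description is a finite multiset $s$ of triplets $(q,m,n)\in S\times\mathbb N\times\mathbb N$. A transition $s\to s'$ replaces one occurrence of a triplet $(q_i,m,n)$ in $s$ by $(q_j,m+1,n)$, by $(q_j,m-1,n)$ (if $m>0$), by $(q_j,m,n+1)$, by $(q_j,m,n-1)$ (if $n>0$), or by the two triplets $(q_j,m,n),(q_k,m,n)$, according to an instruction of the respective kind. $M$ accepts from $s$ if $s\to^\ast s'$ for some $s'$ all of whose members are $(q_F,0,0)$. Work in propositional linear logic LL (multiplicatives, additives, units, exponentials, axiom and cut), with one-sided sequents that are finite multisets of formulas. Represent the states by pairwise distinct atoms of the same names, let $a,b$ be two further distinct atoms, and put $x^0=1$, $x^1=x$, $x^{n+1}=x^n\otimes x$ for $n\ge 1$. Encode the five kinds of instructions respectively by the formulas $$?\bigl((q_i^\bot\mathbin{⅋}(q_j\otimes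 a))^\bot\bigr),\quad ?\bigl(((q_i\otimes a)^\bot\mathbin{⅋}q_j)^\bot\bigr),\quad ?\bigl((q_i^\bot\mathbin{⅋}(q_j\otimes b))^\bot\bigr),\quad ?\bigl(((q_i\otimes b)^\bot\mathbin{⅋}q_j)^\bot\bigr),\quad ?\bigl((q_i^\bot\mathbin{⅋}(q_j\oplus q_k))^\bot\bigr),$$ and let $\vdash'\Gamma$ denote the sequent $\vdash\Gamma$ extended by the encodings of all the instructions of $M$. **Proposition 4.1.** For every such machine $M$ and every instantaneous description $s$, $M$ accepts from $s$ if and only if, for every triplet $(q,m,n)\in s$, the sequent $\vdash' q^\bot,(a^m)^\bot,(b^n)^\bot,q_F$ is provable in LL. Moreover, provability of sequents in propositional LL (over countably many atoms) is undecidable. -/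

import Mathlib

/-! ## Propositional linear logic -/

/-- Formulas of propositional linear logic over a type `V` of atoms, in negation normal form:
negation is a connective on atoms only (`natom p` is the negated atom); `amp` is the additive
conjunction. -/
inductive LLFormula (V : Type*) where
  | atom (p : V)
  | natom (p : V)
  | one
  | bot
  | zero
  | top
  | tensor (A B : LLFormula V)
  | par (A B : LLFormula V)
  | plus (A B : LLFormula V)
  | amp (A B : LLFormula V)
  | bang (A : LLFormula V)
  | quest (A : LLFormula V)

namespace LLFormula

/-- Linear negation, defined by the De Morgan laws. -/
def dual {V : Type*} : LLFormula V → LLFormula V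
  | atom p => natom p
  | natom p => atom p
  | one => bot
  | bot => one
  | zero => top
  | top => zero
  | tensor A B => par A.dual B.dual
  | par A B => tensor A.dual B.dual
  | plus A B => amp A.dual B.dual
  | amp A B => plus A.dual B.dual
  | bang A => quest A.dual
  | quest A => bang A.dual

theorem dual_dual {V : Type*} (A : LLFormula V) : A.dual.dual = A := by
  induction A <;> simp_all [dual]

/-- Tensor powers of a formula: the zeroth power is `1`, the first is `A` itself, and the
`(n+1)`-st is the `n`-th power tensor `A`. -/
def pow {V : Type*} (A : LLFormula V) : ℕ → LLFormula V
  | 0 => one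
  | 1 => A
  | n + 2 => tensor (A.pow (n + 1)) A

/-- An explicit Goedel numbering of the formulas whose atoms are natural numbers. -/
def code : LLFormula ℕ → ℕ
  | atom p => Nat.pair 0 p
  | natom p => Nat.pair 1 p
  | one => Nat.pair 2 0
  | bot => Nat.pair 3 0
  | zero => Nat.pair 4 0
  | top => Nat.pair 5 0
  | tensor A B => Nat.pair 6 (Nat.pair A.code B.code)
  | par A B => Nat.pair 7 (Nat.pair A.code B.code)
  | plus A B => Nat.pair 8 (Nat.pair A.code B.code)
  | amp A B => Nat.pair 9 (Nat.pair A.code B.code)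
  | bang A => Nat.pair 10 A.code
  | quest A => Nat.pair 11 A.code

theorem code_injective : Function.Injective code := by
  intro A
  induction A with
  | tensor A B hA hB | par A B hA hB | plus A B hA hB | amp A B hA hB =>
    intro C h
    cases C <;> simp [code, Nat.pair_eq_pair] at h ⊢
    exact ⟨hA h.1, hB h.2⟩
  | bang A hA | quest A hA =>
    intro C h
    cases C <;> simp [code, Nat.pair_eq_pair] at h ⊢
    exact hA h
  | _ =>
    intro C h
    cases C <;> simp_all [code, Nat.pair_eq_pair]

end LLFormula

open LLFormula in
/-- Provability of one-sided sequents in propositional linear logic. A sequent is a finite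
multiset of formulas, so the exchange rule is built in. -/
inductive LLProvable {V : Type*} : Multiset (LLFormula V) → Prop
  | ax (A : LLFormula V) : LLProvable {A, A.dual}
  | cut (A : LLFormula V) (Γ₁ Γ₂ : Multiset (LLFormula V)) :
      LLProvable (A ::ₘ Γ₁) → LLProvable (A.dual ::ₘ Γ₂) → LLProvable (Γ₁ + Γ₂)
  | par (A B : LLFormula V) (Γ : Multiset (LLFormula V)) :
      LLProvable (A ::ₘ B ::ₘ Γ) → LLProvable (LLFormula.par A B ::ₘ Γ)
  | tensor (A B : LLFormula V) (Γ₁ Γ₂ : Multiset (LLFormula V)) :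
      LLProvable (A ::ₘ Γ₁) → LLProvable (B ::ₘ Γ₂) →
        LLProvable (LLFormula.tensor A B ::ₘ (Γ₁ + Γ₂))
  | plusLeft (A B : LLFormula V) (Γ : Multiset (LLFormula V)) :
      LLProvable (A ::ₘ Γ) → LLProvable (plus A B ::ₘ Γ)
  | plusRight (A B : LLFormula V) (Γ : Multiset (LLFormula V)) :
      LLProvable (B ::ₘ Γ) → LLProvable (plus A B ::ₘ Γ)
  | amp (A B : LLFormula V) (Γ : Multiset (LLFormula V)) :
      LLProvable (A ::ₘ Γ) → LLProvable (B ::ₘ Γ) → LLProvable (LLFormula.amp A B ::ₘ Γ)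
  | one : LLProvable {LLFormula.one}
  | bot (Γ : Multiset (LLFormula V)) : LLProvable Γ → LLProvable (LLFormula.bot ::ₘ Γ)
  | top (Γ : Multiset (LLFormula V)) : LLProvable (LLFormula.top ::ₘ Γ)
  | contraction (A : LLFormula V) (Γ : Multiset (LLFormula V)) :
      LLProvable (quest A ::ₘ quest A ::ₘ Γ) → LLProvable (quest A ::ₘ Γ)
  | weakening (A : LLFormula V) (Γ : Multiset (LLFormula V)) :
      LLProvable Γ → LLProvable (quest A ::ₘ Γ)
  | dereliction (A : LLFormula V) (Γ : Multiset (LLFormula V)) :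
      LLProvable (A ::ₘ Γ) → LLProvable (quest A ::ₘ Γ)
  | promotion (A : LLFormula V) (Γ : Multiset (LLFormula V)) :
      LLProvable (A ::ₘ Γ.map quest) → LLProvable (bang A ::ₘ Γ.map quest)

/-- The Goedel number of a sequent, given as a list of formulas with atoms in `ℕ`. -/
def sequentCode (Γ : List (LLFormula ℕ)) : ℕ :=
  Encodable.encode (Γ.map LLFormula.code)

theorem sequentCode_injective : Function.Injective sequentCode :=
  Encodable.encode_injective.comp (List.map_injective_iff.2 LLFormula.code_injective)

/-- Provability in propositional linear logic (over countably many atoms) is decidable: the set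
of Goedel numbers of provable sequents is computable. -/
def LLDecidable : Prop :=
  ComputablePred fun n : ℕ =>
    ∃ Γ : List (LLFormula ℕ), sequentCode Γ = n ∧ LLProvable (Γ : Multiset (LLFormula ℕ))

/-! ## Two-counter machines with fork -/

/-- A two-counter machine with fork instructions and with states in `S`. The instruction sets
are finite. -/
structure TCM (S : Type*) where
  /-- the initial state -/
  qI : S
  /-- the final state -/
  qF : S
  /-- increment counter `A` -/
  incA : Finset (S × S)
  /-- decrement counter `A` -/
  decA : Finset (S × S)
  /-- increment counter `B` -/
  incB : Finset (S × S)
  /-- decrement counter `B` -/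
  decB : Finset (S × S)
  /-- fork -/
  fork : Finset (S × S × S)

namespace TCM

/-- One transition between instantaneous descriptions, i.e. finite multisets of triplets
`(state, value of A, value of B)`. In each case `s` is the untouched rest of the multiset. -/
inductive Step {S : Type*} (M : TCM S) : Multiset (S × ℕ × ℕ) → Multiset (S × ℕ × ℕ) → Prop
  | incA (q q' : S) (m n : ℕ) (s : Multiset (S × ℕ × ℕ)) (h : (q, q') ∈ M.incA) :
      M.Step ((q, m, n) ::ₘ s) ((q', m + 1, n) ::ₘ s)
  | decA (q q' : S) (m n : ℕ) (s : Multiset (S × ℕ × ℕ)) (h : (q, q') ∈ M.decA) (hm : 0 < m) :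
      M.Step ((q, m, n) ::ₘ s) ((q', m - 1, n) ::ₘ s)
  | incB (q q' : S) (m n : ℕ) (s : Multiset (S × ℕ × ℕ)) (h : (q, q') ∈ M.incB) :
      M.Step ((q, m, n) ::ₘ s) ((q', m, n + 1) ::ₘ s)
  | decB (q q' : S) (m n : ℕ) (s : Multiset (S × ℕ × ℕ)) (h : (q, q') ∈ M.decB) (hn : 0 < n) :
      M.Step ((q, m, n) ::ₘ s) ((q', m, n - 1) ::ₘ s)
  | fork (q q' q'' : S) (m n : ℕ) (s : Multiset (S × ℕ × ℕ)) (h : (q, q', q'') ∈ M.fork) :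
      M.Step ((q, m, n) ::ₘ s) ((q', m, n) ::ₘ (q'', m, n) ::ₘ s)

/-- `M` accepts from `s`: some finite sequence of transitions leads from `s` to a multiset all of
whose members are `(qF, 0, 0)`. -/
def Accepts {S : Type*} (M : TCM S) (s : Multiset (S × ℕ × ℕ)) : Prop :=
  ∃ s', Relation.ReflTransGen M.Step s s' ∧ ∀ t ∈ s', t = (M.qF, 0, 0)

open LLFormula in
/-- The multiset of the formulas encoding the instructions of `M`, where the state `q` is
represented by the atom `st q` and the counters by the atoms `a` and `b`. -/
def theory {S V : Type*} (M : TCM S) (st : S → V) (a b : V) : Multiset (LLFormula V) :=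
  M.incA.val.map (fun i =>
      quest (dual (par (dual (atom (st i.1))) (tensor (atom (st i.2)) (atom a))))) +
  M.decA.val.map (fun i =>
      quest (dual (par (dual (tensor (atom (st i.1)) (atom a))) (atom (st i.2))))) +
  M.incB.val.map (fun i =>
      quest (dual (par (dual (atom (st i.1))) (tensor (atom (st i.2)) (atom b))))) +
  M.decB.val.map (fun i =>
      quest (dual (par (dual (tensor (atom (st i.1)) (atom b))) (atom (st i.2))))) +
  M.fork.val.map (fun i =>
      quest (dual (par (dual (atom (st i.1))) (plus (atom (st i.2.1)) (atom (st i.2.2))))))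

open LLFormula in
/-- The sequent encoding the triplet `(q, m, n)`, with the instructions of `M` added. -/
def sequent {S V : Type*} (M : TCM S) (st : S → V) (a b : V) (q : S) (m n : ℕ) :
    Multiset (LLFormula V) :=
  {dual (atom (st q)), dual ((atom a).pow m), dual ((atom b).pow n), atom (st M.qF)} +
    M.theory st a b

end TCM

/-!
Since forked copies never interact, acceptance is a property of single triplets, defined by
recursion along the run (`TCM.Acc`), and `TCM.accepts_iff_forall_acc` reduces the first claim to one
triplet.

A run gives a proof of the sequent: each transition, read backwards, is one use of the corresponding
instruction, available by dereliction and contraction (`TCM.Acc.provable`). Conversely, no cut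
elimination is needed: linear logic is sound for phase semantics
(`LLFormula.refutations_subset_of_provable`), and we take the free commutative monoid on the atoms,
with the accepted triplets `q + m a + n b` as pole. In this phase space all instructions are valid,
because a triplet is accepted when the result of one of its transitions is, so that the validity of
the sequent of a triplet says that this triplet is accepted (`TCM.acc_of_provable`).

For undecidability, it suffices to exhibit one machine, running a universal partial recursive
function, with undecidable acceptance from the inputs `(qI, p ^ n, 0)`; then
`n ↦ ⊢' qI^⊥, (a ^ (p ^ n))^⊥, 1^⊥, qF` is a computable reduction of the halting problem to
provability. Registers are stored on counter `A` as exponents of distinct primes, and a fork into a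
branch that empties the other counter tests a counter for zero. More generally, forks are
conjunctions, and guesses are existential quantifiers, so a machine can be programmed by
writing a recursive definition of a predicate on the registers (`Prog`): what the machine accepts
is the least family of predicates that satisfies the definitions (`Prog.of_acc_call`,
`Prog.acc_call`). The graphs of the partial recursive functions are defined in this way by
recursion on `Nat.Partrec.Code` (`Proc.body`). No stack is needed, since every call takes place in a
branch with its own copy of the registers.
-/

/-! ### Acceptance of a single triplet -/

namespace TCM

variable {S : Type*}

/-- `M.Acc q m n`: the triplet `(q, m, n)` is accepted, defined by recursion along the run. Since
the members of an instantaneous description evolve independently, acceptance is a property of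
triplets: a fork succeeds when both of its branches do. -/
inductive Acc (M : TCM S) : S → ℕ → ℕ → Prop
  | final : M.Acc M.qF 0 0
  | incA {q q' : S} {m n : ℕ} (h : (q, q') ∈ M.incA) (H : M.Acc q' (m + 1) n) : M.Acc q m n
  | decA {q q' : S} {m n : ℕ} (h : (q, q') ∈ M.decA) (H : M.Acc q' m n) : M.Acc q (m + 1) n
  | incB {q q' : S} {m n : ℕ} (h : (q, q') ∈ M.incB) (H : M.Acc q' m (n + 1)) : M.Acc q m n
  | decB {q q' : S} {m n : ℕ} (h : (q, q') ∈ M.decB) (H : M.Acc q' m n) : M.Acc q m (n + 1)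
  | fork {q q' q'' : S} {m n : ℕ} (h : (q, q', q'') ∈ M.fork) (H' : M.Acc q' m n)
      (H'' : M.Acc q'' m n) : M.Acc q m n

theorem Step.add_left {M : TCM S} {s s' : Multiset (S × ℕ × ℕ)} (h : M.Step s s')
    (t : Multiset (S × ℕ × ℕ)) : M.Step (t + s) (t + s') := by
  cases h <;> simp only [Multiset.add_cons]
  · exact .incA _ _ _ _ _ ‹_›
  · exact .decA _ _ _ _ _ ‹_› ‹_›
  · exact .incB _ _ _ _ _ ‹_›
  · exact .decB _ _ _ _ _ ‹_› ‹_›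
  · exact .fork _ _ _ _ _ _ ‹_›

theorem Accepts.of_step {M : TCM S} {s s' : Multiset (S × ℕ × ℕ)} (h : M.Step s s')
    (h' : M.Accepts s') : M.Accepts s :=
  let ⟨t, ht, hf⟩ := h'
  ⟨t, .head h ht, hf⟩

theorem Accepts.add {M : TCM S} {s t : Multiset (S × ℕ × ℕ)} (hs : M.Accepts s)
    (ht : M.Accepts t) : M.Accepts (s + t) := by
  obtain ⟨s', hs, hfs⟩ := hs
  obtain ⟨t', ht, hft⟩ := ht
  have h₁ : Relation.ReflTransGen M.Step (s + t) (s' + t) :=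
    hs.lift (· + t) fun x y h => by simpa only [add_comm _ t] using h.add_left t
  have h₂ : Relation.ReflTransGen M.Step (s' + t) (s' + t') :=
    ht.lift (s' + ·) fun x y h => h.add_left s'
  refine ⟨s' + t', h₁.trans h₂, ?_⟩
  · intro x hx
    rcases Multiset.mem_add.1 hx with hx | hx
    exacts [hfs x hx, hft x hx]

theorem Acc.accepts {M : TCM S} {q : S} {m n : ℕ} (h : M.Acc q m n) : M.Accepts {(q, m, n)} := by
  induction h with
  | final => exact ⟨_, .refl, by simp⟩
  | incA h _ ih => exact ih.of_step (.incA _ _ _ _ 0 h)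
  | decA h _ ih => exact ih.of_step (.decA _ _ (_ + 1) _ 0 h (Nat.succ_pos _))
  | incB h _ ih => exact ih.of_step (.incB _ _ _ _ 0 h)
  | decB h _ ih => exact ih.of_step (.decB _ _ _ (_ + 1) 0 h (Nat.succ_pos _))
  | fork h _ _ ih ih' => exact (ih.add ih').of_step (.fork _ _ _ _ _ 0 h)

theorem Acc.of_step {M : TCM S} {s s' : Multiset (S × ℕ × ℕ)} (h : M.Step s s')
    (h' : ∀ t ∈ s', M.Acc t.1 t.2.1 t.2.2) : ∀ t ∈ s, M.Acc t.1 t.2.1 t.2.2 := by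
  cases h with
  | incA q q' m n s h =>
    simp only [Multiset.forall_mem_cons] at h' ⊢
    exact ⟨h'.1.incA h, h'.2⟩
  | decA q q' m n s h hm =>
    simp only [Multiset.forall_mem_cons] at h' ⊢
    obtain ⟨m, rfl⟩ := Nat.exists_eq_succ_of_ne_zero hm.ne'
    exact ⟨.decA h h'.1, h'.2⟩
  | incB q q' m n s h =>
    simp only [Multiset.forall_mem_cons] at h' ⊢
    exact ⟨h'.1.incB h, h'.2⟩
  | decB q q' m n s h hn =>
    simp only [Multiset.forall_mem_cons] at h' ⊢
    obtain ⟨n, rfl⟩ := Nat.exists_eq_succ_of_ne_zero hn.ne'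
    exact ⟨.decB h h'.1, h'.2⟩
  | fork q q' q'' m n s h =>
    simp only [Multiset.forall_mem_cons] at h' ⊢
    exact ⟨.fork h h'.1 h'.2.1, h'.2.2⟩

theorem accepts_iff_forall_acc {M : TCM S} {s : Multiset (S × ℕ × ℕ)} :
    M.Accepts s ↔ ∀ t ∈ s, M.Acc t.1 t.2.1 t.2.2 := by
  constructor
  · rintro ⟨s', h, hf⟩
    induction h using Relation.ReflTransGen.head_induction_on with
    | refl =>
      intro t ht
      rw [hf t ht]
      exact .final
    | head h _ ih => exact Acc.of_step h ih
  · intro h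
    induction s using Multiset.induction with
    | empty => exact ⟨0, .refl, by simp⟩
    | cons t s ih =>
      rw [Multiset.forall_mem_cons] at h
      rw [← Multiset.singleton_add]
      exact h.1.accepts.add (ih h.2)

end TCM

/-! ### Accepted triplets have provable sequents -/

namespace LLProvable

open LLFormula

variable {V : Type*}

/-- Dereliction followed by contraction: a formula of a reusable hypothesis may be used once
more. -/
theorem of_quest_mem {A : LLFormula V} {Γ : Multiset (LLFormula V)} (hA : quest A ∈ Γ)
    (h : LLProvable (A ::ₘ Γ)) : LLProvable Γ := by
  obtain ⟨Δ, rfl⟩ := Multiset.exists_cons_of_mem hA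
  exact contraction _ _ (dereliction _ _ h)

theorem add_of_forall_quest {Γ Θ : Multiset (LLFormula V)} (h : LLProvable Γ)
    (hΘ : ∀ A ∈ Θ, ∃ B, A = quest B) : LLProvable (Γ + Θ) := by
  induction Θ using Multiset.induction with
  | empty => simpa
  | cons A Θ ih =>
    rw [Multiset.forall_mem_cons] at hΘ
    obtain ⟨B, rfl⟩ := hΘ.1
    rw [Multiset.add_cons]
    exact weakening _ _ (ih hΘ.2)

theorem dual_pow_of_replicate (A : LLFormula V) (m : ℕ) {Γ : Multiset (LLFormula V)}
    (h : LLProvable (Multiset.replicate m A.dual + Γ)) : LLProvable ((A.pow m).dual ::ₘ Γ) := by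
  induction m using Nat.twoStepInduction generalizing Γ with
  | zero => exact bot _ (by simpa using h)
  | one => simpa [pow] using h
  | more n _ ih =>
    refine par _ _ _ (ih ?_)
    rwa [Multiset.replicate_succ, Multiset.cons_add, ← Multiset.add_cons] at h

/-- Use of a reusable implication `A ⊸ B` from the hypotheses: it reduces a goal with
hypothesis `A` to the same goal with hypothesis `B`. -/
theorem modus_ponens {A B : LLFormula V} {Γ Δ Ω : Multiset (LLFormula V)}
    (hmem : quest (LLFormula.par A.dual B).dual ∈ Ω) (hA : LLProvable (A ::ₘ Γ))
    (hB : LLProvable (B.dual ::ₘ Δ)) (hΩ : Γ + Δ = Ω) : LLProvable Ω := by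
  refine of_quest_mem hmem ?_
  rw [dual, dual_dual, ← hΩ]
  exact tensor _ _ _ _ hA hB

end LLProvable

namespace TCM

open LLFormula Multiset

variable {S V : Type*}

theorem exists_eq_quest_of_mem_theory {M : TCM S} {st : S → V} {a b : V} {A : LLFormula V}
    (h : A ∈ M.theory st a b) : ∃ B, A = quest B := by
  simp only [theory, mem_add, mem_map] at h
  rcases h with (((⟨i, _, rfl⟩ | ⟨i, _, rfl⟩) | ⟨i, _, rfl⟩) | ⟨i, _, rfl⟩) | ⟨i, _, rfl⟩ <;>
    exact ⟨_, rfl⟩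

theorem mem_theory_incA {M : TCM S} {st : S → V} {a b : V} {q q' : S}
    (h : (q, q') ∈ M.incA) :
    quest (dual (par (dual (atom (st q))) (tensor (atom (st q')) (atom a)))) ∈ M.theory st a b := by
  simp only [theory, mem_add]
  exact .inl (.inl (.inl (.inl (mem_map_of_mem _ h))))

theorem mem_theory_decA {M : TCM S} {st : S → V} {a b : V} {q q' : S}
    (h : (q, q') ∈ M.decA) :
    quest (dual (par (dual (tensor (atom (st q)) (atom a))) (atom (st q')))) ∈ M.theory st a b := by
  simp only [theory, mem_add]
  exact .inl (.inl (.inl (.inr (mem_map_of_mem _ h))))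

theorem mem_theory_incB {M : TCM S} {st : S → V} {a b : V} {q q' : S}
    (h : (q, q') ∈ M.incB) :
    quest (dual (par (dual (atom (st q))) (tensor (atom (st q')) (atom b)))) ∈ M.theory st a b := by
  simp only [theory, mem_add]
  exact .inl (.inl (.inr (mem_map_of_mem _ h)))

theorem mem_theory_decB {M : TCM S} {st : S → V} {a b : V} {q q' : S}
    (h : (q, q') ∈ M.decB) :
    quest (dual (par (dual (tensor (atom (st q)) (atom b))) (atom (st q')))) ∈ M.theory st a b := by
  simp only [theory, mem_add]
  exact .inl (.inr (mem_map_of_mem _ h))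

theorem mem_theory_fork {M : TCM S} {st : S → V} {a b : V} {q q' q'' : S}
    (h : (q, q', q'') ∈ M.fork) :
    quest (dual (par (dual (atom (st q))) (plus (atom (st q')) (atom (st q''))))) ∈ M.theory st a b := by
  simp only [theory, mem_add]
  exact .inr (mem_map_of_mem _ h)

theorem Acc.provable_replicate {M : TCM S} (st : S → V) (a b : V) {q : S} {m n : ℕ}
    (h : M.Acc q m n) :
    LLProvable (natom (st q) ::ₘ (replicate m (natom a) + (replicate n (natom b) +
      (atom (st M.qF) ::ₘ M.theory st a b)))) := by
  have hax : ∀ p : V, LLProvable (atom p ::ₘ {natom p}) := fun p => .ax (atom p)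
  have htens : ∀ p p' : V, LLProvable (LLFormula.tensor (atom p) (atom p') ::ₘ
      ({natom p} + {natom p'})) := fun p p' => .tensor _ _ _ _ (hax p) (hax p')
  induction h with
  | final =>
    have := (LLProvable.ax (atom (st M.qF))).add_of_forall_quest
      (Θ := M.theory st a b) fun A hA => exists_eq_quest_of_mem_theory hA
    convert this using 1
    simp only [dual, insert_eq_cons, replicate_zero, zero_add, cons_add, singleton_add]
    rw [cons_swap]
  | @incA q q' m n h _ ih =>
    refine LLProvable.modus_ponens (A := atom (st q)) (B := .tensor (atom (st q')) (atom a))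
      ?_ (hax _) (.par _ _ (replicate m (natom a) + (replicate n (natom b) +
      (atom (st M.qF) ::ₘ M.theory st a b))) ?_) ?_
    · simp only [mem_cons, mem_add]
      exact .inr (.inr (.inr (.inr (mem_theory_incA h))))
    · rwa [replicate_succ, cons_add] at ih
    · rw [singleton_add]
  | @decA q q' m n h _ ih =>
    refine LLProvable.modus_ponens (A := .tensor (atom (st q)) (atom a)) (B := atom (st q'))
      ?_ (htens _ _) ih ?_
    · simp only [mem_cons, mem_add]
      exact .inr (.inr (.inr (.inr (mem_theory_decA h))))
    · simp only [replicate_succ, ← singleton_add]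
      abel
  | @incB q q' m n h _ ih =>
    refine LLProvable.modus_ponens (A := atom (st q)) (B := .tensor (atom (st q')) (atom b))
      ?_ (hax _) (.par _ _ (replicate m (natom a) + (replicate n (natom b) +
      (atom (st M.qF) ::ₘ M.theory st a b))) ?_) ?_
    · simp only [mem_cons, mem_add]
      exact .inr (.inr (.inr (.inr (mem_theory_incB h))))
    · rwa [replicate_succ, cons_add, add_cons] at ih
    · rw [singleton_add]
  | @decB q q' m n h _ ih =>
    refine LLProvable.modus_ponens (A := .tensor (atom (st q)) (atom b)) (B := atom (st q'))
      ?_ (htens _ _) ih ?_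
    · simp only [mem_cons, mem_add]
      exact .inr (.inr (.inr (.inr (mem_theory_decB h))))
    · simp only [replicate_succ, ← singleton_add]
      abel
  | @fork q q' q'' m n h _ _ ih ih' =>
    refine LLProvable.modus_ponens (A := atom (st q))
      (B := .plus (atom (st q')) (atom (st q''))) ?_ (hax _) (.amp _ _ _ ih ih') ?_
    · simp only [mem_cons, mem_add]
      exact .inr (.inr (.inr (.inr (mem_theory_fork h))))
    · rw [singleton_add]

theorem Acc.provable {M : TCM S} (st : S → V) (a b : V) {q : S} {m n : ℕ}
    (h : M.Acc q m n) : LLProvable (M.sequent st a b q m n) := by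
  have := h.provable_replicate st a b
  rw [← add_cons] at this
  have := LLProvable.dual_pow_of_replicate (atom a) m this
  rw [cons_swap, ← add_cons, ← add_cons] at this
  have := LLProvable.dual_pow_of_replicate (atom b) n this
  convert this using 1
  simp only [sequent, insert_eq_cons, cons_add, singleton_add, dual]
  rw [cons_swap _ (natom (st q)), cons_swap (dual _) (dual _)]

end TCM

/-! ### Phase semantics -/

namespace LLFormula

open Set Pointwise

variable {V N : Type*} [AddCommMonoid N]

/-- The orthogonal of `X` with respect to the pole `P`. -/
def orth (P X : Set N) : Set N := {y | ∀ x ∈ X, x + y ∈ P}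

theorem mem_orth {P X : Set N} {y : N} : y ∈ orth P X ↔ ∀ x ∈ X, x + y ∈ P := .rfl

theorem subset_orth_orth (P X : Set N) : X ⊆ orth P (orth P X) := fun x hx y hy => by
  rw [add_comm]
  exact hy x hx

theorem orth_anti (P : Set N) {X Y : Set N} (h : X ⊆ Y) : orth P Y ⊆ orth P X :=
  fun _ hy x hx => hy x (h hx)

theorem orth_orth_orth (P X : Set N) : orth P (orth P (orth P X)) = orth P X :=
  (orth_anti P (subset_orth_orth P X)).antisymm (subset_orth_orth P _)

theorem orth_union (P X Y : Set N) : orth P (X ∪ Y) = orth P X ∩ orth P Y := by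
  ext z
  simp only [mem_orth, mem_union, or_imp, forall_and, mem_inter_iff]

theorem orth_orth_add_subset (P X Y : Set N) :
    orth P (orth P X) + orth P (orth P Y) ⊆ orth P (orth P (X + Y)) := by
  rintro _ ⟨x, hx, y, hy, rfl⟩ z hz
  have h : ∀ x' ∈ X, x' + z ∈ orth P Y := fun x' hx' y' hy' => by
    rw [← add_assoc, add_comm y']
    exact hz (x' + y') (add_mem_add hx' hy')
  have h' : y + z ∈ orth P X := fun x' hx' => by
    rw [add_left_comm, add_comm y]
    exact hy _ (h x' hx')
  show z + (x + y) ∈ P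
  rw [add_left_comm, add_comm, add_comm z]
  exact hx _ h'

/-- Interpretation of the formulas in the phase space given by the pole `P`, where `v` interprets
the atoms. The exponentials are interpreted with `{0}` as the submonoid of reusable resources, which
is possible in every phase space. -/
def sem (P : Set N) (v : V → N) : LLFormula V → Set N
  | atom p => orth P (orth P {v p})
  | natom p => orth P {v p}
  | one => orth P (orth P {0})
  | bot => orth P {0}
  | zero => orth P univ
  | top => univ
  | tensor A B => orth P (orth P (A.sem P v + B.sem P v))
  | par A B => orth P (orth P (A.sem P v) + orth P (B.sem P v))
  | plus A B => orth P (orth P (A.sem P v ∪ B.sem P v))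
  | amp A B => A.sem P v ∩ B.sem P v
  | bang A => orth P (orth P (A.sem P v ∩ {0}))
  | quest A => orth P (orth P (A.sem P v) ∩ {0})

theorem orth_univ_orth (P : Set N) : orth P (orth P univ) = univ :=
  eq_univ_of_univ_subset (subset_orth_orth P univ)

/-- Linear negation is interpreted by the orthogonal, and every formula by a biorthogonally closed
set. Each claim needs the other one for the subformulas. -/
theorem sem_dual_and_orth_orth (P : Set N) (v : V → N) (A : LLFormula V) :
    A.dual.sem P v = orth P (A.sem P v) ∧ orth P (orth P (A.sem P v)) = A.sem P v := by
  induction A with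
  | atom p | natom p | one | bot => simp [dual, sem, orth_orth_orth]
  | zero | top => simp [dual, sem, orth_univ_orth]
  | tensor A B hA hB | par A B hA hB =>
    simp [dual, sem, orth_orth_orth, hA.1, hA.2, hB.1, hB.2]
  | plus A B hA hB =>
    simp only [dual, sem, orth_orth_orth, hA.1, hB.1, ← orth_union, and_true]
  | amp A B hA hB =>
    have h : A.sem P v ∩ B.sem P v = orth P (orth P (A.sem P v) ∪ orth P (B.sem P v)) := by
      rw [orth_union, hA.2, hB.2]
    simp only [dual, sem, hA.1, hB.1, h, orth_orth_orth, and_true]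
  | bang A hA | quest A hA =>
    simp [dual, sem, orth_orth_orth, hA.1, hA.2]

theorem sem_dual (P : Set N) (v : V → N) (A : LLFormula V) :
    A.dual.sem P v = orth P (A.sem P v) :=
  (sem_dual_and_orth_orth P v A).1

theorem orth_orth_sem (P : Set N) (v : V → N) (A : LLFormula V) :
    orth P (orth P (A.sem P v)) = A.sem P v :=
  (sem_dual_and_orth_orth P v A).2

/-- The sums of one refutation (element of the orthogonal) for each formula of a sequent. -/
def refutations (P : Set N) (v : V → N) (Γ : Multiset (LLFormula V)) : Set N :=
  (Γ.map fun A => orth P (A.sem P v)).sum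

theorem refutations_cons (P : Set N) (v : V → N) (A : LLFormula V) (Γ : Multiset (LLFormula V)) :
    refutations P v (A ::ₘ Γ) = orth P (A.sem P v) + refutations P v Γ := by
  simp [refutations]

theorem refutations_add (P : Set N) (v : V → N) (Γ Δ : Multiset (LLFormula V)) :
    refutations P v (Γ + Δ) = refutations P v Γ + refutations P v Δ := by
  simp [refutations]

theorem add_subset_pole_iff {P X Y : Set N} : orth P X + Y ⊆ P ↔ Y ⊆ orth P (orth P X) := by
  rw [add_subset_iff]
  exact ⟨fun h y hy x hx => h x hx y hy, fun h x hx y hy => h hy x hx⟩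

theorem refutations_cons_subset_iff {P : Set N} {v : V → N} {A : LLFormula V}
    {Γ : Multiset (LLFormula V)} :
    refutations P v (A ::ₘ Γ) ⊆ P ↔ refutations P v Γ ⊆ A.sem P v := by
  rw [refutations_cons, add_subset_pole_iff, orth_orth_sem]

/-- The refutations of a context `?Γ` are in the biorthogonal of their part in `{0}`: this is what
the promotion rule needs. -/
theorem refutations_map_quest_subset {P : Set N} {v : V → N} (Γ : Multiset (LLFormula V)) :
    refutations P v (Γ.map quest) ⊆
      orth P (orth P (refutations P v (Γ.map quest) ∩ {0})) := by
  induction Γ using Multiset.induction with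
  | empty =>
    intro x hx
    refine subset_orth_orth P _ ⟨hx, ?_⟩
    simpa [refutations] using hx
  | cons A Γ ih =>
    rw [Multiset.map_cons, refutations_cons]
    have h : orth P ((quest A).sem P v) ⊆ orth P (orth P (orth P ((quest A).sem P v) ∩ {0})) := by
      refine orth_anti _ (orth_anti _ ?_)
      exact subset_inter (subset_orth_orth _ _) inter_subset_right
    refine (add_subset_add h ih).trans ((orth_orth_add_subset _ _ _).trans
      (orth_anti _ (orth_anti _ ?_)))
    rintro _ ⟨x, ⟨hx, hx0⟩, y, ⟨hy, hy0⟩, rfl⟩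
    refine ⟨add_mem_add hx hy, ?_⟩
    simp_all

/-- Soundness of linear logic for phase semantics. -/
theorem refutations_subset_of_provable (P : Set N) (v : V → N) {Γ : Multiset (LLFormula V)}
    (h : LLProvable Γ) : refutations P v Γ ⊆ P := by
  induction h with
  | ax A =>
    rw [Multiset.insert_eq_cons, refutations_cons_subset_iff, ← orth_orth_sem, ← sem_dual]
    simp [refutations]
  | cut A Γ₁ Γ₂ _ _ ih₁ ih₂ =>
    rw [refutations_cons_subset_iff] at ih₁ ih₂
    rw [sem_dual] at ih₂
    rw [refutations_add]
    rintro _ ⟨x, hx, y, hy, rfl⟩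
    exact ih₂ hy x (ih₁ hx)
  | par A B Γ _ ih =>
    rw [refutations_cons_subset_iff, sem]
    rw [refutations_cons, refutations_cons, ← add_assoc] at ih
    intro y hy x hx
    exact ih (add_mem_add hx hy)
  | tensor A B Γ₁ Γ₂ _ _ ih₁ ih₂ =>
    rw [refutations_cons_subset_iff] at ih₁ ih₂ ⊢
    rw [refutations_add, sem]
    exact (add_subset_add ih₁ ih₂).trans (subset_orth_orth _ _)
  | plusLeft A B Γ _ ih =>
    rw [refutations_cons_subset_iff] at ih ⊢
    exact ih.trans (subset_union_left.trans (subset_orth_orth _ _))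
  | plusRight A B Γ _ ih =>
    rw [refutations_cons_subset_iff] at ih ⊢
    exact ih.trans (subset_union_right.trans (subset_orth_orth _ _))
  | amp A B Γ _ _ ih₁ ih₂ =>
    rw [refutations_cons_subset_iff] at ih₁ ih₂ ⊢
    exact subset_inter ih₁ ih₂
  | one =>
    rw [← Multiset.cons_zero, refutations_cons_subset_iff]
    simpa [refutations, sem] using subset_orth_orth P {0}
  | bot Γ _ ih =>
    rw [refutations_cons_subset_iff]
    intro y hy x hx
    rw [mem_singleton_iff.1 hx, zero_add]
    exact ih hy
  | top Γ =>
    rw [refutations_cons_subset_iff]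
    exact subset_univ _
  | contraction A Γ _ ih =>
    rw [refutations_cons, refutations_cons] at ih
    rw [refutations_cons_subset_iff]
    intro y hy x hx
    have h0 : x = 0 := hx.2
    have := ih (add_mem_add (subset_orth_orth _ _ hx) (add_mem_add (subset_orth_orth _ _ hx) hy))
    simpa [h0] using this
  | weakening A Γ _ ih =>
    rw [refutations_cons_subset_iff]
    rintro y hy x ⟨-, rfl⟩
    rw [zero_add]
    exact ih hy
  | dereliction A Γ _ ih =>
    rw [refutations_cons_subset_iff] at ih ⊢
    rw [← orth_orth_sem] at ih
    exact ih.trans (orth_anti _ inter_subset_left)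
  | promotion A Γ _ ih =>
    rw [refutations_cons_subset_iff] at ih ⊢
    exact (refutations_map_quest_subset Γ).trans
      (orth_anti _ (orth_anti _ (inter_subset_inter_left _ ih)))

/-- The tensor power of an atom contains the corresponding multiple of its value. -/
theorem nsmul_mem_sem_pow (P : Set N) (v : V → N) (p : V) (n : ℕ) :
    n • v p ∈ ((atom p).pow n).sem P v := by
  induction n using Nat.twoStepInduction with
  | zero => simpa [pow, sem] using subset_orth_orth P {0} rfl
  | one => simpa [pow, sem] using subset_orth_orth P {v p} rfl
  | more n _ ih =>
    rw [succ_nsmul]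
    exact subset_orth_orth _ _ (add_mem_add ih (subset_orth_orth P {v p} rfl))

theorem orth_orth_subset_sem {P X : Set N} {v : V → N} {A : LLFormula V} (h : X ⊆ A.sem P v) :
    orth P (orth P X) ⊆ A.sem P v := by
  rw [← orth_orth_sem]
  exact orth_anti _ (orth_anti _ h)

theorem sem_tensor_subset {P : Set N} {v : V → N} {p p' : V} {A : LLFormula V}
    (h : v p + v p' ∈ A.sem P v) :
    ((atom p).tensor (atom p')).sem P v ⊆ A.sem P v := by
  refine orth_orth_subset_sem ((orth_orth_add_subset _ _ _).trans (orth_orth_subset_sem ?_))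
  rwa [singleton_add_singleton, singleton_subset_iff]

theorem mem_sem_tensor {P : Set N} {v : V → N} {p p' : V} {x : N}
    (h : ∀ z, v p + v p' + z ∈ P → z + x ∈ P) : x ∈ ((atom p).tensor (atom p')).sem P v :=
  fun z hz => h z (hz _ (add_mem_add (subset_orth_orth P {v p} rfl)
    (subset_orth_orth P {v p'} rfl)))

theorem mem_sem_plus {P : Set N} {v : V → N} {p p' : V} {x : N}
    (h : ∀ z, v p + z ∈ P → v p' + z ∈ P → z + x ∈ P) :
    x ∈ ((atom p).plus (atom p')).sem P v :=
  fun z hz => h z (hz _ (.inl (subset_orth_orth P {v p} rfl)))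
    (hz _ (.inr (subset_orth_orth P {v p'} rfl)))

/-- The encoding of a valid implication can be refuted by the resource `0`. -/
theorem zero_mem_orth_sem_quest {P : Set N} {v : V → N} {A B : LLFormula V}
    (h : A.sem P v ⊆ B.sem P v) :
    (0 : N) ∈ orth P ((quest (dual (par A.dual B))).sem P v) := by
  refine subset_orth_orth _ _ ⟨?_, rfl⟩
  rw [← sem_dual, dual_dual, sem, sem_dual, orth_orth_sem]
  rintro _ ⟨x, hx, y, hy, rfl⟩
  rw [add_zero]
  exact hy x (h hx)

theorem zero_mem_refutations {P : Set N} {v : V → N} {Γ : Multiset (LLFormula V)}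
    (h : ∀ A ∈ Γ, (0 : N) ∈ orth P (A.sem P v)) : (0 : N) ∈ refutations P v Γ := by
  induction Γ using Multiset.induction with
  | empty => simp [refutations]
  | cons A Γ ih =>
    rw [Multiset.forall_mem_cons] at h
    rw [refutations_cons]
    exact ⟨0, h.1, 0, ih h.2, add_zero 0⟩

end LLFormula

/-! ### Provable sequents come from accepted triplets -/

namespace TCM

open LLFormula Multiset

variable {S V : Type*}

/-- The pole: the multisets of atoms that describe an accepted triplet. -/
def pole (M : TCM S) (st : S → V) (a b : V) : Set (Multiset V) :=
  {X | ∃ q m n, M.Acc q m n ∧ X = st q ::ₘ (replicate m a + replicate n b)}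

theorem cons_mem_pole {M : TCM S} {st : S → V} {a b : V} (hst : Function.Injective st)
    (ha : ∀ q, st q ≠ a) (hb : ∀ q, st q ≠ b) {q : S} {X : Multiset V}
    (h : st q ::ₘ X ∈ M.pole st a b) :
    ∃ m n, M.Acc q m n ∧ X = replicate m a + replicate n b := by
  obtain ⟨q', m, n, h, e⟩ := h
  have hq : st q ∈ st q' ::ₘ (replicate m a + replicate n b) := e ▸ mem_cons_self _ _
  simp only [mem_cons, mem_add, mem_replicate, ha, hb, and_false, or_false, hst.eq_iff] at hq
  subst hq
  exact ⟨m, n, h, (cons_inj_right _).1 e⟩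

theorem add_replicate_eq_cons_left {a b : V} (hab : a ≠ b) {m n : ℕ} {X : Multiset V}
    (h : a ::ₘ X = replicate m a + replicate n b) :
    ∃ k, m = k + 1 ∧ X = replicate k a + replicate n b := by
  have ha : a ∈ replicate m a + replicate n b := h ▸ mem_cons_self _ _
  simp only [mem_add, mem_replicate, hab, and_false, or_false, and_true] at ha
  obtain ⟨k, rfl⟩ := Nat.exists_eq_succ_of_ne_zero ha
  exact ⟨k, rfl, (cons_inj_right a).1 (by rw [h, replicate_succ, cons_add])⟩

theorem acc_of_cons_mem_pole {M : TCM S} {st : S → V} {a b : V} (hst : Function.Injective st)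
    (hab : a ≠ b) (ha : ∀ q, st q ≠ a) (hb : ∀ q, st q ≠ b) {q : S} {m n : ℕ}
    (h : st q ::ₘ (replicate m a + replicate n b) ∈ M.pole st a b) : M.Acc q m n := by
  classical
  obtain ⟨m', n', h, e⟩ := cons_mem_pole hst ha hb h
  have h₁ := congrArg (count a) e
  have h₂ := congrArg (count b) e
  simp only [count_add, count_replicate, hab, hab.symm, if_true, if_false, add_zero,
    zero_add] at h₁ h₂
  rwa [h₁, h₂]

theorem Acc.mem_pole {M : TCM S} {st : S → V} {a b : V} {q : S} {m n : ℕ} (h : M.Acc q m n) :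
    st q ::ₘ (replicate m a + replicate n b) ∈ M.pole st a b :=
  ⟨q, m, n, h, rfl⟩

/-- The instructions are valid implications in the phase space of the machine, because acceptance
is preserved backwards by transitions; hence their encodings are all refuted by `0`. -/
theorem zero_mem_refutations_theory {M : TCM S} {st : S → V} {a b : V}
    (hst : Function.Injective st) (hab : a ≠ b) (ha : ∀ q, st q ≠ a) (hb : ∀ q, st q ≠ b) :
    (0 : Multiset V) ∈ refutations (M.pole st a b) singleton (M.theory st a b) := by
  have hP : ∀ {q : S} {m n : ℕ} (X : Multiset V), M.Acc q m n →
      X = st q ::ₘ (replicate m a + replicate n b) → X ∈ M.pole st a b :=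
    fun X h e => e ▸ h.mem_pole
  refine zero_mem_refutations fun A hA => ?_
  simp only [theory, mem_add, mem_map] at hA
  rcases hA with (((⟨⟨q, q'⟩, h, rfl⟩ | ⟨⟨q, q'⟩, h, rfl⟩) | ⟨⟨q, q'⟩, h, rfl⟩) |
    ⟨⟨q, q'⟩, h, rfl⟩) | ⟨⟨q, q', q''⟩, h, rfl⟩
  · refine zero_mem_orth_sem_quest (orth_orth_subset_sem (Set.singleton_subset_iff.2
      (mem_sem_tensor fun X hX => ?_)))
    rw [add_assoc, singleton_add, singleton_add] at hX
    obtain ⟨m, n, hacc, e⟩ := cons_mem_pole hst ha hb hX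
    obtain ⟨m, rfl, rfl⟩ := add_replicate_eq_cons_left hab e
    exact hP _ (.incA h hacc) (by rw [← singleton_add, add_comm])
  · refine zero_mem_orth_sem_quest (sem_tensor_subset ?_)
    intro X hX
    obtain ⟨m, n, hacc, rfl⟩ := cons_mem_pole hst ha hb (hX _ rfl)
    refine hP _ (.decA h hacc) ?_
    simp only [replicate_succ, ← singleton_add]
    abel
  · refine zero_mem_orth_sem_quest (orth_orth_subset_sem (Set.singleton_subset_iff.2
      (mem_sem_tensor fun X hX => ?_)))
    rw [add_assoc, singleton_add, singleton_add] at hX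
    obtain ⟨m, n, hacc, e⟩ := cons_mem_pole hst ha hb hX
    rw [add_comm] at e
    obtain ⟨n, rfl, rfl⟩ := add_replicate_eq_cons_left hab.symm e
    exact hP _ (.incB h hacc) (by rw [← singleton_add, add_comm, add_comm (replicate m a)])
  · refine zero_mem_orth_sem_quest (sem_tensor_subset ?_)
    intro X hX
    obtain ⟨m, n, hacc, rfl⟩ := cons_mem_pole hst ha hb (hX _ rfl)
    refine hP _ (.decB h hacc) ?_
    simp only [replicate_succ, ← singleton_add]
    abel
  · refine zero_mem_orth_sem_quest (orth_orth_subset_sem (Set.singleton_subset_iff.2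
      (mem_sem_plus fun X hX hX' => ?_)))
    obtain ⟨m, n, hacc, rfl⟩ := cons_mem_pole hst ha hb hX
    refine hP _ (.fork h hacc (acc_of_cons_mem_pole hst hab ha hb hX')) ?_
    rw [← singleton_add, add_comm]

theorem acc_of_provable {M : TCM S} {st : S → V} {a b : V} (hst : Function.Injective st)
    (hab : a ≠ b) (ha : ∀ q, st q ≠ a) (hb : ∀ q, st q ≠ b) {q : S} {m n : ℕ}
    (h : LLProvable (M.sequent st a b q m n)) : M.Acc q m n := by
  have hsub := refutations_subset_of_provable (M.pole st a b) singleton h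
  have hmem : ∀ (p : V) (k : ℕ), replicate k p ∈
      orth (M.pole st a b) (((atom p).pow k).dual.sem (M.pole st a b) singleton) := fun p k => by
    rw [← sem_dual, dual_dual, ← nsmul_singleton]
    exact nsmul_mem_sem_pow _ singleton p k
  have hq : {st q} ∈ orth (M.pole st a b)
      ((dual (atom (st q))).sem (M.pole st a b) singleton) := by
    simpa [pow] using hmem (st q) 1
  have hF : 0 ∈ orth (M.pole st a b) ((atom (st M.qF)).sem (M.pole st a b) singleton) := by
    rw [sem, orth_orth_orth]
    rintro _ rfl
    simpa using (Acc.final (M := M)).mem_pole (st := st) (a := a) (b := b)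
  simp only [sequent, insert_eq_cons, cons_add, singleton_add, refutations_cons] at hsub
  have := hsub (Set.add_mem_add hq (Set.add_mem_add (hmem a m) (Set.add_mem_add (hmem b n)
    (Set.add_mem_add hF (zero_mem_refutations_theory hst hab ha hb)))))
  rw [add_zero, add_zero, singleton_add] at this
  exact acc_of_cons_mem_pole hst hab ha hb this

theorem accepts_iff_provable {st : S → V} {a b : V} (hst : Function.Injective st) (hab : a ≠ b)
    (ha : ∀ q, st q ≠ a) (hb : ∀ q, st q ≠ b) (M : TCM S) (s : Multiset (S × ℕ × ℕ)) :
    M.Accepts s ↔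
      ∀ (q : S) (m n : ℕ), (q, m, n) ∈ s → LLProvable (M.sequent st a b q m n) := by
  rw [accepts_iff_forall_acc]
  exact ⟨fun h q m n hs => (h _ hs).provable st a b,
    fun h t ht => acc_of_provable hst hab ha hb (h _ _ _ ht)⟩

end TCM

/-! ### A programming language on top of the machines -/

/-- A single instruction of a two-counter machine with fork and states in `S`. -/
inductive Instr (S : Type*) where
  | incA (q q' : S)
  | decA (q q' : S)
  | incB (q q' : S)
  | decB (q q' : S)
  | fork (q q' q'' : S)

/-- The two-counter machine given by a finite set of instructions. -/
noncomputable def Instr.machine {S : Type*} (qI qF : S) (R : Set (Instr S)) (hR : R.Finite) :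
    TCM S where
  qI := qI
  qF := qF
  incA := (hR.preimage (f := fun i : S × S => .incA i.1 i.2)
    fun _ _ _ _ h => by injection h; exact Prod.ext ‹_› ‹_›).toFinset
  decA := (hR.preimage (f := fun i : S × S => .decA i.1 i.2)
    fun _ _ _ _ h => by injection h; exact Prod.ext ‹_› ‹_›).toFinset
  incB := (hR.preimage (f := fun i : S × S => .incB i.1 i.2)
    fun _ _ _ _ h => by injection h; exact Prod.ext ‹_› ‹_›).toFinset
  decB := (hR.preimage (f := fun i : S × S => .decB i.1 i.2)
    fun _ _ _ _ h => by injection h; exact Prod.ext ‹_› ‹_›).toFinset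
  fork := (hR.preimage (f := fun i : S × S × S => .fork i.1 i.2.1 i.2.2)
    fun _ _ _ _ h => by injection h; exact Prod.ext ‹_› (Prod.ext ‹_› ‹_›)).toFinset

theorem Instr.mem_incA_machine {S : Type*} {qI qF q q' : S} {R : Set (Instr S)}
    {hR : R.Finite} : (q, q') ∈ (machine qI qF R hR).incA ↔ incA q q' ∈ R := by
  simp [machine]

theorem Instr.mem_decA_machine {S : Type*} {qI qF q q' : S} {R : Set (Instr S)}
    {hR : R.Finite} : (q, q') ∈ (machine qI qF R hR).decA ↔ decA q q' ∈ R := by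
  simp [machine]

theorem Instr.mem_incB_machine {S : Type*} {qI qF q q' : S} {R : Set (Instr S)}
    {hR : R.Finite} : (q, q') ∈ (machine qI qF R hR).incB ↔ incB q q' ∈ R := by
  simp [machine]

theorem Instr.mem_decB_machine {S : Type*} {qI qF q q' : S} {R : Set (Instr S)}
    {hR : R.Finite} : (q, q') ∈ (machine qI qF R hR).decB ↔ decB q q' ∈ R := by
  simp [machine]

theorem Instr.mem_fork_machine {S : Type*} {qI qF q q' q'' : S} {R : Set (Instr S)}
    {hR : R.Finite} : (q, q', q'') ∈ (machine qI qF R hR).fork ↔ fork q q' q'' ∈ R := by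
  simp [machine]

/-- Programs with registers in `Fin K` and procedures in `L`. A program is run in order to be
accepted, so that it amounts to a condition on the registers (see `Prog.den`): `ex i` overwrites
register `i` by a guess, `and` accepts if both programs do when run on copies of the registers. -/
inductive Prog (K : ℕ) (L : Type) where
  | tt
  | ex (i : Fin K) (P : Prog K L)
  | and (P Q : Prog K L)
  | or (P Q : Prog K L)
  | zero (i : Fin K)
  | inc (i : Fin K) (P : Prog K L)
  | dec (i : Fin K) (P : Prog K L)
  | call (l : L)
  deriving Countable

namespace Prog

open Function

variable {K : ℕ} {L : Type}

/-- The condition on the registers expressed by a program, when the procedures express `J`. -/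
def den (J : L → (Fin K → ℕ) → Prop) : Prog K L → (Fin K → ℕ) → Prop
  | tt, _ => True
  | ex i P, v => ∃ z, P.den J (update v i z)
  | and P Q, v => P.den J v ∧ Q.den J v
  | or P Q, v => P.den J v ∨ Q.den J v
  | zero i, v => v i = 0
  | inc i P, v => P.den J (update v i (v i + 1))
  | dec i P, v => ∃ k, v i = k + 1 ∧ P.den J (update v i k)
  | call l, v => J l v

/-- The prime whose exponent holds register `i`. -/
noncomputable def prime (i : Fin K) : ℕ := Nat.nth Nat.Prime i

theorem prime_prime (i : Fin K) : (prime i).Prime :=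
  Nat.prime_nth_prime i

theorem prime_injective : Injective (prime : Fin K → ℕ) := fun _ _ h =>
  Fin.ext (Nat.nth_injective Nat.infinite_setOfPred_prime h)

/-- The Goedel number of the contents of the registers, to be held by counter `A`. -/
noncomputable def enc (v : Fin K → ℕ) : ℕ := ∏ i, prime i ^ v i

theorem enc_update_succ (v : Fin K → ℕ) (i : Fin K) (k : ℕ) :
    enc (update v i (k + 1)) = prime i * enc (update v i k) := by
  have h : ∀ k, enc (update v i k) = prime i ^ k * ∏ j ∈ Finset.univ.erase i, prime j ^ v j := by
    intro k
    rw [enc, ← Finset.mul_prod_erase _ _ (Finset.mem_univ i), update_self]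
    congr 1
    exact Finset.prod_congr rfl fun j hj => by rw [update_of_ne (Finset.ne_of_mem_erase hj)]
  rw [h, h, pow_succ', mul_assoc]

theorem prime_dvd_enc_iff {v : Fin K → ℕ} {i : Fin K} : prime i ∣ enc v ↔ v i ≠ 0 := by
  constructor
  · intro h h0
    obtain ⟨j, -, hj⟩ := (prime_prime i).prime.exists_mem_finset_dvd h
    have := (Nat.prime_dvd_prime_iff_eq (prime_prime i) (prime_prime j)).1
      ((prime_prime i).dvd_of_dvd_pow hj)
    cases prime_injective this
    rw [h0, pow_zero] at hj
    exact (prime_prime i).one_lt.ne' (Nat.dvd_one.1 hj)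
  · intro h
    exact (dvd_pow_self _ h).trans (Finset.dvd_prod_of_mem _ (Finset.mem_univ i))

/-- The states of the machine that runs a program: the state `prog P` is entered with the Goedel
number of the registers on counter `A` and `0` on counter `B`. From `mul i P j`, the machine adds
`j` plus `prime i` times `A` to `B`, moves `B` to `A` (state `back P`) and runs `P`. From
`div i P j` it adds to `B` the exact quotient of `A + j` by `prime i`, and proceeds likewise. From
`ndvd i j` it checks that `prime i` does not divide `A + j`. -/
inductive State (K : ℕ) (L : Type) where
  | final
  | zeroA
  | zeroB
  | prog (P : Prog K L)
  | back (P : Prog K L)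
  | back' (P : Prog K L)
  | mul (i : Fin K) (P : Prog K L) (j : ℕ)
  | div (i : Fin K) (P : Prog K L) (j : ℕ)
  | ndvd (i : Fin K) (j : ℕ)
  deriving Countable

open State Instr

/-- The unconditional jump from `q` to `q'`, a fork with equal branches. -/
abbrev jump {S : Type*} (q q' : S) : Instr S := fork q q' q'

/-- Instructions that check that a counter is zero, discarding the other counter. -/
def instrsZero : List (Instr (State K L)) :=
  [decB zeroA zeroA, jump zeroA final, decA zeroB zeroB, jump zeroB final]

/-- Instructions that add counter `B` to counter `A`, and then run `P`. -/
def instrsBack (P : Prog K L) : List (Instr (State K L)) :=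
  [decB (back P) (back' P), incA (back' P) (back P), fork (back P) zeroB (prog P)]

/-- Instructions that multiply counter `A` by `prime i`, and then run `P`. -/
noncomputable def instrsInc (i : Fin K) (P : Prog K L) : List (Instr (State K L)) :=
  [jump (prog (inc i P)) (mul i P 0), decA (mul i P 0) (mul i P (prime i)),
    fork (mul i P 0) zeroA (back P)] ++
  (List.range (prime i)).map (fun j => incB (mul i P (j + 1)) (mul i P j)) ++ instrsBack P

/-- Instructions that divide counter `A` by `prime i`, provided that this is exact, and then run
`P`. -/
noncomputable def instrsDec (i : Fin K) (P : Prog K L) : List (Instr (State K L)) :=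
  [jump (prog (dec i P)) (div i P 0), incB (div i P (prime i)) (div i P 0),
    fork (div i P 0) zeroA (back P)] ++
  (List.range (prime i)).map (fun j => decA (div i P j) (div i P (j + 1))) ++ instrsBack P

/-- The instructions needed to run a program up to the calls of procedures. -/
noncomputable def instrs : Prog K L → List (Instr (State K L))
  | tt => [decA (prog tt) (prog tt), jump (prog tt) final]
  | ex i P => [jump (prog (ex i P)) (prog (inc i (ex i P))),
      jump (prog (ex i P)) (prog (dec i (ex i P))), jump (prog (ex i P)) (prog P)] ++
      instrsInc i (ex i P) ++ instrsDec i (ex i P) ++ P.instrs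
  | and P Q => fork (prog (and P Q)) (prog P) (prog Q) :: (P.instrs ++ Q.instrs)
  | or P Q => jump (prog (or P Q)) (prog P) :: jump (prog (or P Q)) (prog Q) ::
      (P.instrs ++ Q.instrs)
  | zero i => [jump (prog (zero i)) (ndvd i 0), jump (ndvd i (prime i)) (ndvd i 0)] ++
      (List.range (prime i)).map (fun j => decA (ndvd i j) (ndvd i (j + 1))) ++
      (List.range (prime i - 1)).map (fun j => jump (ndvd i (j + 1)) zeroA)
  | inc i P => instrsInc i P ++ P.instrs
  | dec i P => instrsDec i P ++ P.instrs
  | call _ => []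

/-- The instructions needed to run the procedures of the set `T`, with bodies given by `D`. -/
def instrsOf (D : L → Prog K L) (T : Set L) : Set (Instr (State K L)) :=
  {x | x ∈ instrsZero} ∪ ⋃ l ∈ T, {x | x ∈ jump (prog (call l)) (prog (D l)) :: (D l).instrs}

theorem finite_instrsOf (D : L → Prog K L) {T : Set L} (hT : T.Finite) :
    (instrsOf D T).Finite :=
  (List.finite_toSet _).union (hT.biUnion fun _ _ => List.finite_toSet _)

/-- The machine that runs the procedure `l`, using the procedures of the finite set `T`. -/
noncomputable def machine (D : L → Prog K L) {T : Set L} (hT : T.Finite) (l : L) :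
    TCM (State K L) :=
  Instr.machine (prog (call l)) final (instrsOf D T) (finite_instrsOf D hT)

/-- The invariant of the compiled machine: what the acceptance of a triplet entails, provided that
the procedures entail `J`. -/
def Inv (J : L → (Fin K → ℕ) → Prop) : State K L → ℕ → ℕ → Prop
  | final, m, n => m = 0 ∧ n = 0
  | zeroA, m, _ => m = 0
  | zeroB, _, n => n = 0
  | prog P, m, n => n = 0 → ∀ v, m = enc v → P.den J v
  | back P, m, n => ∀ v, m + n = enc v → P.den J v
  | back' P, m, n => ∀ v, m + n + 1 = enc v → P.den J v
  | mul i P j, m, n => ∀ v, prime i * m + n + j = enc v → P.den J v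
  | div i P j, m, n => ∃ t, m + j = prime i * t ∧ ∀ v, n + t = enc v → P.den J v
  | ndvd i j, m, _ => ¬ prime i ∣ m + j

/-- The invariant is preserved backwards by an instruction. -/
def Respects (I : State K L → ℕ → ℕ → Prop) : Instr (State K L) → Prop
  | incA q q' => ∀ m n, I q' (m + 1) n → I q m n
  | decA q q' => ∀ m n, I q' m n → I q (m + 1) n
  | incB q q' => ∀ m n, I q' m (n + 1) → I q m n
  | decB q q' => ∀ m n, I q' m n → I q m (n + 1)
  | fork q q' q'' => ∀ m n, I q' m n → I q'' m n → I q m n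

theorem respects_instrsBack (J : L → (Fin K → ℕ) → Prop) (P : Prog K L) :
    ∀ x ∈ instrsBack P, Respects (Inv J) x := by
  simp only [instrsBack, List.forall_mem_cons, List.not_mem_nil, false_imp_iff, implies_true,
    and_true, Respects, Inv]
  refine ⟨fun m n h v hv => h v (by omega), fun m n h v hv => h v (by omega), ?_⟩
  rintro m _ rfl h v hv
  exact h rfl v hv

theorem respects_instrsInc (J : L → (Fin K → ℕ) → Prop) (i : Fin K) (P : Prog K L) :
    ∀ x ∈ instrsInc i P, Respects (Inv J) x := by
  simp only [instrsInc, List.forall_mem_append, List.forall_mem_cons, List.not_mem_nil,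
    false_imp_iff, implies_true, and_true, List.forall_mem_map, Respects, Inv]
  refine ⟨⟨⟨?_, ?_, ?_⟩, ?_⟩, respects_instrsBack J P⟩
  · rintro m n h - rfl v rfl
    refine h _ ?_
    rw [enc_update_succ, update_eq_self, add_zero, add_zero]
  · intro m n h v hv
    exact h v (by rw [← hv]; ring)
  · rintro _ n rfl h v hv
    exact h v (by rw [← hv]; ring)
  · intro j _ m n h v hv
    exact h v (by rw [← hv]; ring)

theorem respects_instrsDec (J : L → (Fin K → ℕ) → Prop) (i : Fin K) (P : Prog K L) :
    ∀ x ∈ instrsDec i P, Respects (Inv J) x := by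
  simp only [instrsDec, List.forall_mem_append, List.forall_mem_cons, List.not_mem_nil,
    false_imp_iff, implies_true, and_true, List.forall_mem_map, Respects, Inv]
  refine ⟨⟨⟨?_, ?_, ?_⟩, ?_⟩, respects_instrsBack J P⟩
  · rintro m n h - rfl v rfl
    obtain ⟨t, ht, H⟩ := h
    rw [add_zero] at ht
    obtain ⟨k, hk⟩ := Nat.exists_eq_add_one_of_ne_zero (prime_dvd_enc_iff.1 ⟨t, ht⟩)
    refine ⟨k, hk, H _ ?_⟩
    have := enc_update_succ v i k
    rw [← hk, update_eq_self, ht] at this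
    rw [zero_add]
    exact Nat.eq_of_mul_eq_mul_left (prime_prime i).pos this
  · rintro m n ⟨t, ht, H⟩
    refine ⟨t + 1, by rw [mul_add, ← ht]; ring, fun v hv => H v (by rw [← hv]; ring)⟩
  · rintro _ n rfl h
    exact ⟨0, rfl, fun v hv => h v (by rw [← hv]; ring)⟩
  · rintro j _ m n ⟨t, ht, H⟩
    exact ⟨t, by rw [← ht]; ring, H⟩

theorem respects_instrs (J : L → (Fin K → ℕ) → Prop) (P : Prog K L) :
    ∀ x ∈ P.instrs, Respects (Inv J) x := by
  induction P with
  | tt =>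
    simp [instrs, Respects, Inv, den]
  | ex i P ih =>
    simp only [instrs, List.forall_mem_append]
    refine ⟨⟨⟨?_, respects_instrsInc J i _⟩, respects_instrsDec J i _⟩, ih⟩
    simp only [List.forall_mem_cons, List.not_mem_nil, false_imp_iff, implies_true, and_true,
      Respects, Inv, den, update_idem]
    refine ⟨fun m n h _ => h, fun m n h _ hn v hv => ?_, fun m n h _ hn v hv => ⟨v i, ?_⟩⟩
    · obtain ⟨_, -, h⟩ := h hn v hv
      exact h
    · rw [update_eq_self]
      exact h hn v hv
  | and P Q ihP ihQ =>
    simp only [instrs, List.forall_mem_append, List.forall_mem_cons]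
    exact ⟨fun m n h h' hn v hv => ⟨h hn v hv, h' hn v hv⟩, ihP, ihQ⟩
  | or P Q ihP ihQ =>
    simp only [instrs, List.forall_mem_append, List.forall_mem_cons]
    exact ⟨fun m n h _ hn v hv => .inl (h hn v hv), fun m n h _ hn v hv => .inr (h hn v hv),
      ihP, ihQ⟩
  | zero i =>
    simp only [instrs, List.forall_mem_append, List.forall_mem_cons, List.not_mem_nil,
      false_imp_iff, implies_true, and_true, List.forall_mem_map, Respects, Inv, den]
    refine ⟨⟨⟨?_, ?_⟩, ?_⟩, ?_⟩
    · rintro m n h - rfl v rfl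
      rw [add_zero, prime_dvd_enc_iff, not_not] at h
      exact h
    · intro m n h _
      rwa [Nat.dvd_add_self_right]
    · intro j _ m n h
      rwa [add_right_comm]
    · rintro j hj _ n rfl - h
      have := Nat.le_of_dvd (by omega) h
      have := List.mem_range.1 hj
      omega
  | inc i P ih =>
    simp only [instrs, List.forall_mem_append]
    exact ⟨respects_instrsInc J i P, ih⟩
  | dec i P ih =>
    simp only [instrs, List.forall_mem_append]
    exact ⟨respects_instrsDec J i P, ih⟩
  | call l => simp [instrs]

/-- Soundness of the machine: an accepted procedure entails any family of conditions that is
closed under the bodies of the procedures. -/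
theorem of_acc_call {D : L → Prog K L} {T : Set L} {hT : T.Finite} {l₀ : L}
    {J : L → (Fin K → ℕ) → Prop} (hJ : ∀ l v, (D l).den J v → J l v) {l : L} {v : Fin K → ℕ}
    (h : (machine D hT l₀).Acc (prog (call l)) (enc v) 0) : J l v := by
  have key : ∀ x ∈ instrsOf D T, Respects (Inv J) x := by
    rintro x (hx | hx)
    · revert x
      change ∀ x ∈ instrsZero, Respects (Inv J) x
      simp +contextual [instrsZero, Respects, Inv]
    · obtain ⟨l, hl, hx⟩ := Set.mem_iUnion₂.1 hx
      rcases List.mem_cons.1 hx with rfl | hx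
      · exact fun m n h _ hn v hv => hJ l v (h hn v hv)
      · exact respects_instrs J _ x hx
  have inv : ∀ q m n, (machine D hT l₀).Acc q m n → Inv J q m n := by
    intro q m n h
    induction h with
    | final => exact ⟨rfl, rfl⟩
    | incA h _ ih => exact key _ (mem_incA_machine.1 h) _ _ ih
    | decA h _ ih => exact key _ (mem_decA_machine.1 h) _ _ ih
    | incB h _ ih => exact key _ (mem_incB_machine.1 h) _ _ ih
    | decB h _ ih => exact key _ (mem_decB_machine.1 h) _ _ ih
    | fork h _ _ ih ih' => exact key _ (mem_fork_machine.1 h) _ _ ih ih'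
  exact inv _ _ _ h rfl v rfl

section Completeness

variable {D : L → Prog K L} {T : Set L} {hT : T.Finite} {l₀ : L}

theorem acc_incA {q q' : State K L} (h : incA q q' ∈ instrsOf D T) {m n : ℕ}
    (H : (machine D hT l₀).Acc q' (m + 1) n) : (machine D hT l₀).Acc q m n :=
  .incA (mem_incA_machine.2 h) H

theorem acc_decA {q q' : State K L} (h : decA q q' ∈ instrsOf D T) {m n : ℕ}
    (H : (machine D hT l₀).Acc q' m n) : (machine D hT l₀).Acc q (m + 1) n :=
  .decA (mem_decA_machine.2 h) H

theorem acc_incB {q q' : State K L} (h : incB q q' ∈ instrsOf D T) {m n : ℕ}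
    (H : (machine D hT l₀).Acc q' m (n + 1)) : (machine D hT l₀).Acc q m n :=
  .incB (mem_incB_machine.2 h) H

theorem acc_decB {q q' : State K L} (h : decB q q' ∈ instrsOf D T) {m n : ℕ}
    (H : (machine D hT l₀).Acc q' m n) : (machine D hT l₀).Acc q m (n + 1) :=
  .decB (mem_decB_machine.2 h) H

theorem acc_fork {q q' q'' : State K L} (h : fork q q' q'' ∈ instrsOf D T) {m n : ℕ}
    (H : (machine D hT l₀).Acc q' m n) (H' : (machine D hT l₀).Acc q'' m n) :
    (machine D hT l₀).Acc q m n :=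
  .fork (mem_fork_machine.2 h) H H'

theorem acc_jump {q q' : State K L} (h : jump q q' ∈ instrsOf D T) {m n : ℕ}
    (H : (machine D hT l₀).Acc q' m n) : (machine D hT l₀).Acc q m n :=
  acc_fork h H H

theorem acc_final : (machine D hT l₀).Acc final 0 0 := .final

theorem acc_zeroA (n : ℕ) : (machine D hT l₀).Acc zeroA 0 n := by
  induction n with
  | zero => exact acc_jump (.inl (by simp [instrsZero])) acc_final
  | succ n ih => exact acc_decB (.inl (by simp [instrsZero])) ih

theorem acc_zeroB (m : ℕ) : (machine D hT l₀).Acc zeroB m 0 := by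
  induction m with
  | zero => exact acc_jump (.inl (by simp [instrsZero])) acc_final
  | succ n ih => exact acc_decA (.inl (by simp [instrsZero])) ih

theorem acc_back {P : Prog K L} (hP : ∀ x ∈ instrsBack P, x ∈ instrsOf D T) {m n : ℕ}
    (h : (machine D hT l₀).Acc (prog P) (m + n) 0) : (machine D hT l₀).Acc (back P) m n := by
  induction n generalizing m with
  | zero => exact acc_fork (hP _ (by simp [instrsBack])) (acc_zeroB _) h
  | succ n ih =>
    refine acc_decB (q' := back' P) (hP _ (by simp [instrsBack]))
      (acc_incA (q' := back P) (hP _ (by simp [instrsBack])) ?_)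
    exact ih (by rwa [add_right_comm])

theorem acc_inc {i : Fin K} {P : Prog K L} (hP : ∀ x ∈ instrsInc i P, x ∈ instrsOf D T) {m : ℕ}
    (h : (machine D hT l₀).Acc (prog P) (prime i * m) 0) :
    (machine D hT l₀).Acc (prog (inc i P)) m 0 := by
  refine acc_jump (q' := mul i P 0) (hP _ (by simp [instrsInc])) ?_
  have add : ∀ j ≤ prime i, ∀ m n, (machine D hT l₀).Acc (mul i P 0) m (n + j) →
      (machine D hT l₀).Acc (mul i P j) m n := by
    intro j
    induction j with
    | zero => exact fun _ m n h => h
    | succ j ih =>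
      intro hj m n h
      refine acc_incB (hP _ ?_) (ih (by omega) m (n + 1) (by rwa [add_right_comm]))
      simp only [instrsInc, List.mem_append, List.mem_map, List.mem_range]
      exact .inl (.inr ⟨j, by omega, rfl⟩)
  have loop : ∀ m n, (machine D hT l₀).Acc (prog P) (prime i * m + n) 0 →
      (machine D hT l₀).Acc (mul i P 0) m n := by
    intro m
    induction m with
    | zero =>
      intro n h
      refine acc_fork (hP (fork (mul i P 0) zeroA (back P)) (by simp [instrsInc])) (acc_zeroA n)
        (acc_back (fun x hx => hP x (by simp [instrsInc, hx])) ?_)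
      rwa [mul_zero] at h
    | succ m ih =>
      intro n h
      refine acc_decA (hP _ (by simp [instrsInc])) (add _ le_rfl _ _ (ih _ ?_))
      rwa [mul_add, mul_one, add_assoc, add_comm (prime i)] at h
  exact loop m 0 h

theorem acc_dec {i : Fin K} {P : Prog K L} (hP : ∀ x ∈ instrsDec i P, x ∈ instrsOf D T) {m : ℕ}
    (h : (machine D hT l₀).Acc (prog P) m 0) :
    (machine D hT l₀).Acc (prog (dec i P)) (prime i * m) 0 := by
  refine acc_jump (q' := div i P 0) (hP _ (by simp [instrsDec])) ?_
  have sub : ∀ k j, k + j = prime i → ∀ m n,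
      (machine D hT l₀).Acc (div i P (prime i)) m n →
      (machine D hT l₀).Acc (div i P j) (m + k) n := by
    intro k
    induction k with
    | zero =>
      rintro j hj m n h
      rw [zero_add] at hj
      rwa [hj]
    | succ k ih =>
      intro j hj m n h
      refine acc_decA (hP _ ?_) (ih (j + 1) (by omega) m n h)
      simp only [instrsDec, List.mem_append, List.mem_map, List.mem_range]
      exact .inl (.inr ⟨j, by omega, rfl⟩)
  have loop : ∀ m n, (machine D hT l₀).Acc (prog P) (m + n) 0 →
      (machine D hT l₀).Acc (div i P 0) (prime i * m) n := by
    intro m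
    induction m with
    | zero =>
      intro n h
      exact acc_fork (hP (fork (div i P 0) zeroA (back P)) (by simp [instrsDec])) (acc_zeroA n)
        (acc_back (fun x hx => hP x (by simp [instrsDec, hx])) h)
    | succ m ih =>
      intro n h
      rw [mul_add, mul_one]
      refine sub _ 0 rfl _ _ (acc_incB (hP _ (by simp [instrsDec])) (ih _ ?_))
      rwa [add_assoc, add_comm 1] at h
  exact loop m 0 h

theorem acc_zero {i : Fin K} (hP : ∀ x ∈ (zero i : Prog K L).instrs, x ∈ instrsOf D T) {m : ℕ}
    (h : ¬ prime i ∣ m) : (machine D hT l₀).Acc (prog (zero i)) m 0 := by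
  refine acc_jump (q' := ndvd i 0) (hP _ (by simp [instrs])) ?_
  have loop : ∀ m j, j ≤ prime i → ¬ prime i ∣ m + j →
      (machine D hT l₀).Acc (ndvd i j) m 0 := by
    intro m
    induction m with
    | zero =>
      intro j hj h
      have h0 : j ≠ 0 := by rintro rfl; simp at h
      have h1 : j ≠ prime i := by rintro rfl; simp at h
      obtain ⟨j, rfl⟩ := Nat.exists_eq_succ_of_ne_zero h0
      refine acc_jump (hP _ ?_) (acc_zeroA 0)
      simp only [instrs, List.mem_append, List.mem_map, List.mem_range]
      exact .inr ⟨j, by omega, rfl⟩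
    | succ m ih =>
      have lt : ∀ j < prime i, ¬ prime i ∣ m + 1 + j →
          (machine D hT l₀).Acc (ndvd i j) (m + 1) 0 := by
        intro j hj h
        refine acc_decA (hP _ ?_) (ih (j + 1) hj (by rwa [← add_assoc, add_right_comm]))
        simp only [instrs, List.mem_append, List.mem_map, List.mem_range]
        exact .inl (.inr ⟨j, hj, rfl⟩)
      intro j hj h
      rcases hj.lt_or_eq with hj | rfl
      · exact lt j hj h
      · refine acc_jump (hP _ (by simp [instrs])) (lt 0 (prime_prime i).pos ?_)
        rwa [Nat.dvd_add_self_right] at h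
  exact loop m 0 (Nat.zero_le _) h

/-- Completeness of the machine, up to the calls of procedures. -/
theorem acc_of_den {P : Prog K L} (hP : ∀ x ∈ P.instrs, x ∈ instrsOf D T) {v : Fin K → ℕ}
    (h : P.den (fun l v => (machine D hT l₀).Acc (prog (call l)) (enc v) 0) v) :
    (machine D hT l₀).Acc (prog P) (enc v) 0 := by
  induction P generalizing v with
  | tt =>
    generalize enc v = m
    induction m with
    | zero => exact acc_jump (hP _ (by simp [instrs])) acc_final
    | succ m ih => exact acc_decA (hP _ (by simp [instrs])) ih
  | ex i P ih =>
    obtain ⟨z, h⟩ := h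
    simp only [instrs, List.forall_mem_append] at hP
    obtain ⟨⟨⟨hP, hinc⟩, hdec⟩, hP'⟩ := hP
    -- Guessing is done by repeated increments and decrements.
    have step : ∀ k, (machine D hT l₀).Acc (prog (ex i P)) (enc (update v i (k + 1))) 0 ↔
        (machine D hT l₀).Acc (prog (ex i P)) (enc (update v i k)) 0 := by
      intro k
      rw [enc_update_succ]
      exact ⟨fun h => acc_jump (hP _ (by simp)) (acc_inc hinc h),
        fun h => acc_jump (hP _ (by simp)) (acc_dec hdec h)⟩
    have all : ∀ k, (machine D hT l₀).Acc (prog (ex i P)) (enc (update v i k)) 0 ↔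
        (machine D hT l₀).Acc (prog (ex i P)) (enc (update v i 0)) 0 := by
      intro k
      induction k with
      | zero => rfl
      | succ k ih => rw [step, ih]
    rw [← update_eq_self i v, all, ← all z]
    exact acc_jump (hP _ (by simp)) (ih hP' h)
  | and P Q ihP ihQ =>
    simp only [instrs, List.forall_mem_append, List.forall_mem_cons] at hP
    exact acc_fork hP.1 (ihP hP.2.1 h.1) (ihQ hP.2.2 h.2)
  | or P Q ihP ihQ =>
    simp only [instrs, List.forall_mem_append, List.forall_mem_cons] at hP
    rcases h with h | h
    · exact acc_jump hP.1 (ihP hP.2.2.1 h)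
    · exact acc_jump hP.2.1 (ihQ hP.2.2.2 h)
  | zero i =>
    refine acc_zero hP ?_
    rw [prime_dvd_enc_iff, not_not]
    exact h
  | inc i P ih =>
    simp only [instrs, List.forall_mem_append] at hP
    refine acc_inc hP.1 ?_
    have := ih hP.2 h
    rwa [enc_update_succ, update_eq_self] at this
  | dec i P ih =>
    simp only [instrs, List.forall_mem_append] at hP
    obtain ⟨k, hk, h⟩ := h
    have := acc_dec hP.1 (ih hP.2 h)
    rwa [← enc_update_succ, ← hk, update_eq_self] at this
  | call l => exact h

theorem acc_call {l : L} (hl : l ∈ T) {v : Fin K → ℕ}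
    (h : (D l).den (fun l v => (machine D hT l₀).Acc (prog (call l)) (enc v) 0) v) :
    (machine D hT l₀).Acc (prog (call l)) (enc v) 0 := by
  have hT' : ∀ x ∈ jump (prog (call l)) (prog (D l)) :: (D l).instrs, x ∈ instrsOf D T :=
    fun x hx => .inr (Set.mem_iUnion₂.2 ⟨l, hl, hx⟩)
  rw [List.forall_mem_cons] at hT'
  exact acc_jump hT'.1 (acc_of_den hT'.2 h)

end Completeness

end Prog

/-! ### Programs for the partial recursive functions -/

open Nat.Partrec

/-- The procedures. Registers `0` and `1` hold the argument and the value of a function, registers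
`2` to `5` auxiliary values, and registers from `6` on serve for arithmetic. -/
inductive Proc where
  | eq (i j : Fin 9)
  | add (i j l : Fin 9)
  | sq (i : Fin 9)
  | pair (i j l : Fin 9)
  | eval (c : Code)
  | prec (c d : Code)
  | rfind (c : Code)
  deriving Countable

namespace Proc

open Function

/-- The conditions that the procedures are meant to check. -/
def Spec : Proc → (Fin 9 → ℕ) → Prop
  | eq i j, v => v i = v j
  | add i j l, v => i ≠ j → i ≠ l → j ≠ l → v i + v j = v l
  | sq i, v => i < 6 → v 6 = v i * v i
  | pair i j l, v => i < 6 → j < 6 → l < 6 → i ≠ j → i ≠ l → j ≠ l → v l = Nat.pair (v i) (v j)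
  | eval c, v => v 1 ∈ c.eval (v 0)
  | prec c d, v => v 1 ∈ (Code.prec c d).eval (Nat.pair (v 2) (v 3))
  | rfind c, v => v 1 ∈ (Code.rfind' c).eval (Nat.pair (v 2) (v 3))

open Prog in
/-- The bodies of the procedures. As a branch of `and` works on its own copy of the registers, it
may overwrite them when it calls a procedure. -/
def body : Proc → Prog 9 Proc
  | eq i j => or (and (zero i) (zero j)) (dec i (dec j (call (eq i j))))
  | add i j l => or (and (zero i) (call (eq j l))) (dec i (dec l (call (add i j l))))
  | sq i => or (and (zero i) (zero 6)) (dec i (dec 6 (ex 7 (ex 8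
      (and (call (add 7 i 8)) (and (call (add 8 i 6))
        (ex 6 (and (call (eq 6 7)) (call (sq i))))))))))
  | pair i j l => or
      (ex 6 (and (dec j (ex 8 (call (add i 8 j)))) (and (call (sq j)) (call (add 6 i l)))))
      (ex 6 (ex 7 (and (ex 8 (call (add j 8 i))) (and (call (sq i))
        (and (call (add 6 i 7)) (call (add 7 j l)))))))
  | eval .zero => zero 1
  | eval .succ => dec 1 (call (eq 0 1))
  | eval .left => ex 2 (call (pair 1 2 0))
  | eval .right => ex 2 (call (pair 2 1 0))
  | eval (.pair c d) => ex 2 (ex 3 (and (call (pair 2 3 1))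
      (and (ex 1 (and (call (eq 1 2)) (call (eval c))))
        (ex 1 (and (call (eq 1 3)) (call (eval d)))))))
  | eval (.comp c d) => ex 2 (and (ex 1 (and (call (eq 1 2)) (call (eval d))))
      (ex 0 (and (call (eq 0 2)) (call (eval c)))))
  | eval (.prec c d) => ex 2 (ex 3 (and (call (pair 2 3 0)) (call (prec c d))))
  | eval (.rfind' c) => ex 2 (ex 3 (and (call (pair 2 3 0)) (call (rfind c))))
  | prec c d => or (and (zero 3) (ex 0 (and (call (eq 0 2)) (call (eval c)))))
      (dec 3 (ex 4 (and (ex 1 (and (call (eq 1 4)) (call (prec c d))))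
        (ex 5 (and (call (pair 3 4 5)) (ex 0 (and (call (pair 2 5 0)) (call (eval d)))))))))
  | rfind c => or
      (and (call (eq 3 1)) (ex 0 (and (call (pair 2 3 0)) (ex 1 (and (zero 1) (call (eval c)))))))
      (and (ex 0 (and (call (pair 2 3 0)) (ex 1 (and (dec 1 tt) (call (eval c))))))
        (inc 3 (call (rfind c))))

/-- A bound for the codes occurring in a procedure and in those that it calls. -/
def rank : Proc → ℕ
  | eval c => Encodable.encode c
  | prec c d => Encodable.encode (Code.prec c d)
  | rfind c => Encodable.encode (Code.rfind' c)
  | _ => 0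

theorem finite_setOf_rank_le (N : ℕ) : {l | rank l ≤ N}.Finite := by
  have hc : {c : Code | Encodable.encode c ≤ N}.Finite :=
    (Set.finite_Iic N).preimage Encodable.encode_injective.injOn
  refine ((Set.finite_range fun i : Fin 9 × Fin 9 => eq i.1 i.2).union
    ((Set.finite_range fun i : Fin 9 × Fin 9 × Fin 9 => add i.1 i.2.1 i.2.2).union
    ((Set.finite_range sq).union
    ((Set.finite_range fun i : Fin 9 × Fin 9 × Fin 9 => pair i.1 i.2.1 i.2.2).union
    ((hc.image eval).union
    (((hc.prod hc).image fun c => prec c.1 c.2).union (hc.image rfind))))))).subset ?_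
  rintro (⟨i, j⟩ | ⟨i, j, l⟩ | i | ⟨i, j, l⟩ | c | ⟨c, d⟩ | c) h
  · exact .inl ⟨(i, j), rfl⟩
  · exact .inr (.inl ⟨(i, j, l), rfl⟩)
  · exact .inr (.inr (.inl ⟨i, rfl⟩))
  · exact .inr (.inr (.inr (.inl ⟨(i, j, l), rfl⟩)))
  · exact .inr (.inr (.inr (.inr (.inl ⟨c, h, rfl⟩))))
  · have hlt := Code.encode_lt_prec c d
    exact .inr (.inr (.inr (.inr (.inr (.inl ⟨(c, d), ⟨hlt.1.le.trans h, hlt.2.le.trans h⟩, rfl⟩)))))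
  · exact .inr (.inr (.inr (.inr (.inr (.inr ⟨c, (Code.encode_lt_rfind' c).le.trans h, rfl⟩)))))

theorem mem_eval_pair {c d : Code} {x y : ℕ} : y ∈ (Code.pair c d).eval x ↔
    ∃ a ∈ c.eval x, ∃ b ∈ d.eval x, y = Nat.pair a b := by
  simp [Code.eval, Seq.seq, eq_comm]

theorem mem_eval_comp {c d : Code} {x y : ℕ} : y ∈ (Code.comp c d).eval x ↔
    ∃ z ∈ d.eval x, y ∈ c.eval z :=
  Part.mem_bind_iff

theorem mem_eval_prec_zero {c d : Code} {a y : ℕ} :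
    y ∈ (Code.prec c d).eval (Nat.pair a 0) ↔ y ∈ c.eval a := by
  rw [Code.eval_prec_zero]

theorem mem_eval_prec_succ {c d : Code} {a k y : ℕ} :
    y ∈ (Code.prec c d).eval (Nat.pair a (k + 1)) ↔
      ∃ z ∈ (Code.prec c d).eval (Nat.pair a k), y ∈ d.eval (Nat.pair a (Nat.pair k z)) := by
  rw [Code.eval_prec_succ]
  exact Part.mem_bind_iff

theorem mem_eval_rfind {c : Code} {a m y : ℕ} : y ∈ (Code.rfind' c).eval (Nat.pair a m) ↔
    m ≤ y ∧ 0 ∈ c.eval (Nat.pair a y) ∧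
      ∀ k, m ≤ k → k < y → ∃ u, 0 < u ∧ u ∈ c.eval (Nat.pair a k) := by
  have h : ∀ n,
      n ∈ Nat.rfind (fun n => (fun m => decide (m = 0)) <$> c.eval (Nat.pair a (n + m))) ↔
      0 ∈ c.eval (Nat.pair a (n + m)) ∧
        ∀ k < n, ∃ u, 0 < u ∧ u ∈ c.eval (Nat.pair a (k + m)) := fun n => by
    refine Nat.mem_rfind.trans ?_
    simp [Nat.pos_iff_ne_zero, and_comm]
  simp only [Code.eval, Nat.unpaired, Nat.unpair_pair, Part.mem_map_iff, h]
  constructor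
  · rintro ⟨n, ⟨h, h'⟩, rfl⟩
    refine ⟨Nat.le_add_left _ _, h, fun k hk hk' => ?_⟩
    have := h' (k - m) (by omega)
    rwa [Nat.sub_add_cancel hk] at this
  · rintro ⟨hm, h, h'⟩
    obtain ⟨n, rfl⟩ := Nat.exists_eq_add_of_le' hm
    exact ⟨n, ⟨h, fun k hk => h' _ (by omega) (by omega)⟩, rfl⟩

/-- Unbounded search as a recursion: either the search stops at `m`, or it goes on from `m + 1`. -/
theorem mem_eval_rfind_iff {c : Code} {a m y : ℕ} : y ∈ (Code.rfind' c).eval (Nat.pair a m) ↔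
    (m = y ∧ 0 ∈ c.eval (Nat.pair a m)) ∨
      (∃ u, 0 < u ∧ u ∈ c.eval (Nat.pair a m)) ∧ y ∈ (Code.rfind' c).eval (Nat.pair a (m + 1)) := by
  simp only [mem_eval_rfind]
  constructor
  · rintro ⟨hm, h, h'⟩
    rcases hm.eq_or_lt with rfl | hlt
    · exact .inl ⟨rfl, h⟩
    · exact .inr ⟨h' m le_rfl hlt, hlt, h, fun k hk hk' => h' k (by omega) hk'⟩
  · rintro (⟨rfl, h⟩ | ⟨hu, hm, h, h'⟩)
    · exact ⟨le_rfl, h, fun k hk hk' => by omega⟩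
    · refine ⟨by omega, h, fun k hk hk' => ?_⟩
      rcases hk.eq_or_lt with rfl | hlt
      exacts [hu, h' k hlt hk']

theorem mem_eval_iff_exists_pair {c : Code} {x y : ℕ} :
    y ∈ c.eval x ↔ ∃ a b, x = Nat.pair a b ∧ y ∈ c.eval (Nat.pair a b) :=
  ⟨fun h => ⟨x.unpair.1, x.unpair.2, by simp, by simpa using h⟩, fun ⟨_, _, h, hp⟩ => h ▸ hp⟩

/-- The definition of `Nat.pair` in terms of addition and squares. -/
theorem eq_pair_iff {a b c : ℕ} : c = Nat.pair a b ↔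
    (∃ z, b = a + z + 1) ∧ b * b + a = c ∨ (∃ z, b + z = a) ∧ a * a + a + b = c := by
  have h₁ : (∃ z, b = a + z + 1) ↔ a < b :=
    ⟨fun ⟨z, h⟩ => by omega, fun h => ⟨b - a - 1, by omega⟩⟩
  have h₂ : (∃ z, b + z = a) ↔ ¬ a < b :=
    ⟨fun ⟨z, h⟩ => by omega, fun h => ⟨a - b, by omega⟩⟩
  rw [h₁, h₂, Nat.pair]
  split_ifs with h <;> simp [h, eq_comm]

theorem ne_of_lt_six {i : Fin 9} (h : i < 6) : i ≠ 6 ∧ i ≠ 7 ∧ i ≠ 8 := by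
  revert i
  decide

/-- The bodies of the procedures are sound: the conditions `Spec` are closed under them. -/
theorem spec_of_den_body (l : Proc) (v : Fin 9 → ℕ) (h : (body l).den Spec v) : Spec l v := by
  cases l with
  | eq i j =>
    simp only [body, Prog.den, Spec] at h ⊢
    obtain ⟨h, h'⟩ | ⟨k, hk, k', hk', h⟩ := h
    · rw [h, h']
    · rcases eq_or_ne i j with rfl | hij
      · rfl
      · rw [update_of_ne hij.symm] at hk'
        simp only [update_self, update_of_ne hij] at h
        rw [hk, hk', h]
  | add i j l =>
    intro hij hil hjl
    simp [body, Prog.den, Spec, hij, hil, hjl, hij.symm, hil.symm] at h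
    obtain ⟨h, h'⟩ | ⟨k, hk, h⟩ := h <;> omega
  | sq i =>
    intro hi
    obtain ⟨h6, h7, h8⟩ := ne_of_lt_six hi
    simp [body, Prog.den, Spec, hi, h6, h7, h8, h6.symm, h7.symm, h8.symm] at h
    obtain ⟨h, h'⟩ | ⟨k, hk, h⟩ := h
    · rw [h, h']
    · rw [hk, h]
      ring
  | pair i j l =>
    intro hi hj hl hij hil hjl
    obtain ⟨hi6, hi7, hi8⟩ := ne_of_lt_six hi
    obtain ⟨hj6, hj7, hj8⟩ := ne_of_lt_six hj
    obtain ⟨hl6, hl7, hl8⟩ := ne_of_lt_six hl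
    rw [eq_pair_iff]
    simpa [body, Prog.den, Spec, *, hij.symm, hi6.symm, hi7.symm, hi8.symm, hj6.symm, hj7.symm,
      hj8.symm, hl6.symm, hl7.symm, hl8.symm] using h
  | eval c =>
    cases c with
    | zero => simpa [body, Prog.den, Spec, Code.eval, pure, PFun.pure] using h
    | succ => simpa [body, Prog.den, Spec, Code.eval] using h
    | left =>
      obtain ⟨z, h⟩ : ∃ z, v 0 = Nat.pair (v 1) z := by simpa [body, Prog.den, Spec] using h
      simp [Spec, Code.eval, h]
    | right =>
      obtain ⟨z, h⟩ : ∃ z, v 0 = Nat.pair z (v 1) := by simpa [body, Prog.den, Spec] using h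
      simp [Spec, Code.eval, h]
    | pair c d =>
      rw [Spec, mem_eval_pair]
      simp [body, Prog.den, Spec] at h
      obtain ⟨a, b, h, ha, hb⟩ := h
      exact ⟨a, ha, b, hb, h⟩
    | comp c d =>
      rw [Spec, mem_eval_comp]
      simpa [body, Prog.den, Spec] using h
    | prec c d =>
      rw [Spec, mem_eval_iff_exists_pair]
      simpa [body, Prog.den, Spec] using h
    | rfind' c =>
      rw [Spec, mem_eval_iff_exists_pair]
      simpa [body, Prog.den, Spec] using h
  | prec c d =>
    simp [body, Prog.den, Spec] at h
    rw [Spec]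
    obtain ⟨h, h'⟩ | ⟨k, hk, h⟩ := h
    · rwa [h, mem_eval_prec_zero]
    · rwa [hk, mem_eval_prec_succ]
  | rfind c =>
    rw [Spec, mem_eval_rfind_iff]
    simpa [body, Prog.den, Spec] using h

section Completeness

/-! In this section, `A` is the family of conditions on the registers under which the procedures are
accepted by the machine. It entails `Spec`, and is closed under the bodies of rank at most `N`. -/

variable {A : Proc → (Fin 9 → ℕ) → Prop} {N : ℕ}

theorem eq_iff_of_body (hs : ∀ l v, A l v → Spec l v)
    (hc : ∀ l v, rank l ≤ N → (body l).den A v → A l v) {i j : Fin 9} (hij : i ≠ j)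
    {v : Fin 9 → ℕ} : A (eq i j) v ↔ v i = v j := by
  refine ⟨hs _ v, fun h => ?_⟩
  generalize hn : v i = n at h
  induction n generalizing v with
  | zero => exact hc _ _ (Nat.zero_le _) (.inl ⟨hn, h.symm⟩)
  | succ n ih =>
    refine hc _ _ (Nat.zero_le _) (.inr ⟨n, hn, n, ?_, ih ?_ ?_⟩)
    · rw [update_of_ne hij.symm, h]
    · rw [update_of_ne hij, update_self]
    · rw [update_self]

theorem add_iff_of_body (hs : ∀ l v, A l v → Spec l v)
    (hc : ∀ l v, rank l ≤ N → (body l).den A v → A l v) {i j l : Fin 9} (hij : i ≠ j)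
    (hil : i ≠ l) (hjl : j ≠ l) {v : Fin 9 → ℕ} : A (add i j l) v ↔ v i + v j = v l := by
  refine ⟨fun h => hs _ v h hij hil hjl, fun h => ?_⟩
  generalize hn : v i = n at h
  induction n generalizing v with
  | zero =>
    refine hc _ _ (Nat.zero_le _) (.inl ⟨hn, (eq_iff_of_body hs hc hjl).2 ?_⟩)
    rw [← h, zero_add]
  | succ n ih =>
    refine hc _ _ (Nat.zero_le _) (.inr ⟨n, hn, n + v j, ?_, ih ?_ ?_⟩)
    · rw [update_of_ne hil.symm, ← h]
      ring
    · rw [update_of_ne hil, update_self]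
    · rw [update_self, update_of_ne hjl, update_of_ne hij.symm]

theorem sq_iff_of_body (hs : ∀ l v, A l v → Spec l v)
    (hc : ∀ l v, rank l ≤ N → (body l).den A v → A l v) {i : Fin 9} (hi : i < 6)
    {v : Fin 9 → ℕ} : A (sq i) v ↔ v 6 = v i * v i := by
  refine ⟨fun h => hs _ v h hi, fun h => ?_⟩
  obtain ⟨h6, h7, h8⟩ := ne_of_lt_six hi
  generalize hn : v i = n at h
  induction n generalizing v with
  | zero => exact hc _ _ (Nat.zero_le _) (.inl ⟨hn, h⟩)
  | succ n ih =>
    refine hc _ _ (Nat.zero_le _) (.inr ⟨n, hn, n * n + n + n, ?_, n * n, n * n + n, ?_, ?_,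
      n * n, ?_, ih ?_ ?_⟩)
    · rw [update_of_ne h6.symm, h]
      ring
    · refine (add_iff_of_body hs hc h7.symm (by decide) h8).2 ?_
      simp [h6, h7, h8]
    · refine (add_iff_of_body hs hc h8.symm (by decide) h6).2 ?_
      simp [h6, h7, h8]
    · refine (eq_iff_of_body hs hc (by decide)).2 ?_
      simp
    · simp [h6, h7, h8]
    · simp

theorem pair_iff_of_body (hs : ∀ l v, A l v → Spec l v)
    (hc : ∀ l v, rank l ≤ N → (body l).den A v → A l v) {i j l : Fin 9} (hi : i < 6) (hj : j < 6)
    (hl : l < 6) (hij : i ≠ j) (hil : i ≠ l) (hjl : j ≠ l) {v : Fin 9 → ℕ} :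
    A (pair i j l) v ↔ v l = Nat.pair (v i) (v j) := by
  refine ⟨fun h => hs _ v h hi hj hl hij hil hjl, fun h => hc _ _ (Nat.zero_le _) ?_⟩
  obtain ⟨hi6, hi7, hi8⟩ := ne_of_lt_six hi
  obtain ⟨hj6, hj7, hj8⟩ := ne_of_lt_six hj
  obtain ⟨hl6, hl7, hl8⟩ := ne_of_lt_six hl
  rw [eq_pair_iff] at h
  simp [body, Prog.den, add_iff_of_body hs hc, sq_iff_of_body hs hc, *, hij.symm, hi6.symm,
    hi8.symm, hj7.symm, hj8.symm, hl6.symm, hl7.symm]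

theorem eval_iff_of_body (hs : ∀ l v, A l v → Spec l v)
    (hc : ∀ l v, rank l ≤ N → (body l).den A v → A l v) {c : Code} (hN : Encodable.encode c ≤ N)
    {v : Fin 9 → ℕ} : A (eval c) v ↔ v 1 ∈ c.eval (v 0) := by
  refine ⟨hs _ v, fun h => ?_⟩
  have heq := fun {i j} hij {v} => eq_iff_of_body (i := i) (j := j) (v := v) hs hc hij
  have hpair := fun {i j l} hi hj hl hij hil hjl {v} =>
    pair_iff_of_body (i := i) (j := j) (l := l) (v := v) hs hc hi hj hl hij hil hjl
  induction c generalizing v with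
  | zero =>
    refine hc _ _ hN ?_
    simpa [body, Prog.den, Code.eval, pure, PFun.pure] using h
  | succ =>
    refine hc _ _ hN ?_
    simpa [body, Prog.den, heq, Code.eval] using h
  | left =>
    refine hc _ _ hN ⟨(v 0).unpair.2, (hpair (by decide) (by decide) (by decide) (by decide)
      (by decide) (by decide)).2 ?_⟩
    have h : v 1 = (v 0).unpair.1 := by simpa [Code.eval] using h
    simp [h]
  | right =>
    refine hc _ _ hN ⟨(v 0).unpair.1, (hpair (by decide) (by decide) (by decide) (by decide)
      (by decide) (by decide)).2 ?_⟩
    have h : v 1 = (v 0).unpair.2 := by simpa [Code.eval] using h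
    simp [h]
  | pair c d ihc ihd =>
    have hlt := Code.encode_lt_pair c d
    have ihc := fun {v} => Iff.intro (hs (eval c) v) (ihc (hlt.1.le.trans hN))
    have ihd := fun {v} => Iff.intro (hs (eval d) v) (ihd (hlt.2.le.trans hN))
    simp only [Spec] at ihc ihd
    obtain ⟨a, ha, b, hb, h⟩ := mem_eval_pair.1 h
    refine hc _ _ hN ⟨a, b, ?_⟩
    simp [Prog.den, *]
  | comp c d ihc ihd =>
    have hlt := Code.encode_lt_comp c d
    have ihc := fun {v} => Iff.intro (hs (eval c) v) (ihc (hlt.1.le.trans hN))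
    have ihd := fun {v} => Iff.intro (hs (eval d) v) (ihd (hlt.2.le.trans hN))
    simp only [Spec] at ihc ihd
    rw [mem_eval_comp] at h
    refine hc _ _ hN ?_
    simpa [body, Prog.den, heq, ihc, ihd] using h
  | prec c d ihc ihd =>
    have hlt := Code.encode_lt_prec c d
    have ihc := fun {v} => Iff.intro (hs (eval c) v) (ihc (hlt.1.le.trans hN))
    have ihd := fun {v} => Iff.intro (hs (eval d) v) (ihd (hlt.2.le.trans hN))
    simp only [Spec] at ihc ihd
    have key : ∀ {v}, A (prec c d) v ↔ v 1 ∈ (Code.prec c d).eval (Nat.pair (v 2) (v 3)) := by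
      intro v
      refine ⟨hs _ v, fun h => ?_⟩
      generalize hn : v 3 = n at h
      induction n generalizing v with
      | zero =>
        refine hc _ _ hN ?_
        rw [mem_eval_prec_zero] at h
        simp [body, Prog.den, heq, hpair, ihc, ihd, hn, h]
      | succ n ih =>
        obtain ⟨z, hz, h⟩ := mem_eval_prec_succ.1 h
        have hz' := ih (v := update (update (update v 3 n) 4 z) 1 z) (by simp) (by simpa using hz)
        refine hc _ _ hN (.inr ⟨n, hn, z, ⟨z, ?_, hz'⟩, ?_⟩)
        · simp [Prog.den, heq]
        · simp [Prog.den, hpair, ihd, h]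
    refine hc _ _ hN ?_
    rw [mem_eval_iff_exists_pair] at h
    simpa [body, Prog.den, hpair, key] using h
  | rfind' c ihc =>
    have hlt := Code.encode_lt_rfind' c
    have ihc := fun {v} => Iff.intro (hs (eval c) v) (ihc (hlt.le.trans hN))
    simp only [Spec] at ihc
    have key : ∀ {v}, A (rfind c) v ↔ v 1 ∈ (Code.rfind' c).eval (Nat.pair (v 2) (v 3)) := by
      intro v
      refine ⟨hs _ v, fun h => ?_⟩
      obtain ⟨n, hn⟩ := Nat.exists_eq_add_of_le (mem_eval_rfind.1 h).1
      induction n generalizing v with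
      | zero =>
        refine hc _ _ hN ?_
        rcases mem_eval_rfind_iff.1 h with ⟨h3, h0⟩ | h'
        · rw [h3] at h0
          simp [body, Prog.den, heq, hpair, ihc, h3, h0]
        · have := (mem_eval_rfind.1 h'.2).1
          omega
      | succ n ih =>
        refine hc _ _ hN ?_
        rcases mem_eval_rfind_iff.1 h with h' | h'
        · omega
        · have := ih (v := update v 3 (v 3 + 1)) (by simpa using h'.2) (by simp; omega)
          refine .inr ⟨?_, this⟩
          simpa [Prog.den, heq, hpair, ihc] using h'.1
    refine hc _ _ hN ?_
    rw [mem_eval_iff_exists_pair] at h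
    simpa [body, Prog.den, hpair, key] using h

end Completeness

end Proc

/-! ### Undecidability -/

open Nat.Partrec Encodable in
/-- A machine for which acceptance is undecidable: from a power of `p` on counter `A`, it runs a
universal partial recursive function on the exponent. -/
theorem exists_machine_acc_iff_dom : ∃ (S : Type) (_ : Countable S) (M : TCM S) (p : ℕ), 0 < p ∧
    ∀ c : Code, M.Acc M.qI (p ^ encode c) 0 ↔ (c.eval 0).Dom := by
  -- The function takes no value except `0`, so that the register for the value need not be guessed.
  have hf : Partrec fun n : ℕ => (Code.eval (Denumerable.ofNat Code n) 0).map fun _ => 0 :=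
    (Code.eval_part.comp (Computable.ofNat Code) (Computable.const 0)).map
      (Computable.const 0).to₂
  obtain ⟨u, hu⟩ := Code.exists_code.1 (Partrec.nat_iff.1 hf)
  have hT := Proc.finite_setOf_rank_le (encode u)
  let M := Prog.machine Proc.body hT (.eval u)
  have key : ∀ v, M.Acc (.prog (.call (.eval u))) (Prog.enc v) 0 ↔ v 1 ∈ u.eval (v 0) := fun v =>
    Proc.eval_iff_of_body (A := fun l v => M.Acc (.prog (.call l)) (Prog.enc v) 0)
      (fun l v h => Prog.of_acc_call Proc.spec_of_den_body h)
      (fun l v hl h => Prog.acc_call (D := Proc.body) (hT := hT) (l₀ := .eval u) hl h) le_rfl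
  refine ⟨_, inferInstance, M, Prog.prime (0 : Fin 9), (Prog.prime_prime _).pos, fun c => ?_⟩
  have henc : Prog.prime (0 : Fin 9) ^ encode c =
      Prog.enc (Function.update (0 : Fin 9 → ℕ) 0 (encode c)) := by
    rw [Prog.enc, Finset.prod_eq_single 0 (fun i _ hi => by simp [hi]) (by simp)]
    simp
  rw [henc]
  refine (key _).trans ?_
  simp [hu, Part.dom_iff_mem]

namespace LLFormula

theorem primrec_code_dual_pow_atom_succ (p : ℕ) :
    Primrec fun k => code (dual ((atom p).pow (k + 1))) := by
  have h : Primrec₂ fun (_ r : ℕ) => Nat.pair 7 (Nat.pair r (code (natom p))) :=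
    Primrec₂.natPair.comp₂ (Primrec₂.const 7)
      (Primrec₂.natPair.comp₂ Primrec₂.right (Primrec₂.const _))
  refine (Primrec.nat_rec₁ (code (natom p)) h).of_eq fun k => ?_
  induction k with
  | zero => rfl
  | succ k ih =>
    show Nat.pair 7 (Nat.pair _ _) = _
    rw [ih]
    rfl

theorem primrec_code_dual_pow_atom_pow (p : ℕ) {b : ℕ} (hb : 0 < b) :
    Primrec fun n => code (dual ((atom p).pow (b ^ n))) := by
  have hpow : Primrec fun n => b ^ n := by
    have h : Primrec₂ fun (_ r : ℕ) => r * b :=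
      Primrec.nat_mul.comp₂ Primrec₂.right (Primrec₂.const b)
    refine (Primrec.nat_rec₁ 1 h).of_eq fun n => ?_
    induction n with
    | zero => rfl
    | succ n ih => rw [pow_succ, ← ih]
  refine ((primrec_code_dual_pow_atom_succ p).comp (Primrec.pred.comp hpow)).of_eq fun n => ?_
  rw [Nat.pred_eq_sub_one, Nat.sub_add_cancel (Nat.pow_pos hb)]

end LLFormula

open LLFormula in
theorem not_llDecidable : ¬ LLDecidable := by
  intro hdec
  obtain ⟨S, _, M, p, hp, hM⟩ := exists_machine_acc_iff_dom
  obtain ⟨f, hf⟩ := exists_injective_nat S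
  -- The atoms `0` and `1` represent the counters, and the other ones the states.
  let st : S → ℕ := fun q => f q + 2
  have hst : Function.Injective st := fun q q' h => hf (Nat.add_right_cancel h)
  have iff_provable : ∀ m, M.Acc M.qI m 0 ↔ LLProvable (M.sequent st 0 1 M.qI m 0) := fun m =>
    ⟨fun h => h.provable st 0 1, TCM.acc_of_provable hst (by decide) (fun q => by simp [st])
      (fun q => by simp [st])⟩
  let Γ : ℕ → List (LLFormula ℕ) := fun n =>
    dual (atom (st M.qI)) :: dual ((atom 0).pow (p ^ n)) ::
      (dual ((atom 1).pow 0) :: atom (st M.qF) :: (M.theory st 0 1).toList)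
  have hΓ : ∀ n, (Γ n : Multiset (LLFormula ℕ)) = M.sequent st 0 1 M.qI (p ^ n) 0 := fun n => by
    simp only [Γ, TCM.sequent, ← Multiset.cons_coe, Multiset.coe_toList, Multiset.insert_eq_cons,
      Multiset.cons_add, Multiset.singleton_add]
  have hcomp : Primrec fun c : Nat.Partrec.Code => sequentCode (Γ (Encodable.encode c)) := by
    simp only [sequentCode, Γ, List.map_cons]
    exact Primrec.encode.comp (Primrec.list_cons.comp (Primrec.const _) (Primrec.list_cons.comp
      ((primrec_code_dual_pow_atom_pow 0 hp).comp Primrec.encode) (Primrec.const _)))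
  refine ComputablePred.halting_problem 0
    ((ComputablePred.computable_of_manyOneReducible (ManyOneReducible.mk _ hcomp.to_comp)
      hdec).of_eq fun c => ?_)
  rw [← hM, iff_provable, ← hΓ]
  exact ⟨fun ⟨Δ, h, hΔ⟩ => sequentCode_injective h ▸ hΔ, fun h => ⟨_, rfl, h⟩⟩

/-- The atoms representing the states (`st q`) and the two counters (`a`, `b`) are pairwise
distinct. -/
theorem proposition4p1 :
    (∀ (S : Type*) (V : Type*) (st : S → V) (a b : V), Function.Injective st → a ≠ b →
      (∀ q, st q ≠ a) → (∀ q, st q ≠ b) →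
      ∀ (M : TCM S) (s : Multiset (S × ℕ × ℕ)),
        M.Accepts s ↔
          ∀ (q : S) (m n : ℕ), (q, m, n) ∈ s → LLProvable (M.sequent st a b q m n)) ∧
    ¬ LLDecidable :=
  ⟨fun _ _ _ _ _ hst hab ha hb M s => TCM.accepts_iff_provable hst hab ha hb M s,
    not_llDecidable⟩
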